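/- Let $K$ be a commutative ring in which $2$ is not a zero divisor (for instance $K=\mathbb R$ or $\mathbb C$). Let $n,r\ge 0$ be integers with $n$ even, $V=\{1,\dots,n\}$, $R=\{n+1,\dots,n+r\}$, $V^R=V\cup R$. Let $A^R=(a_{ij})_{i,j\in V^R}$ be a skew-symmetric matrix over $K$ such that $\sum_{j\in V^R}a_{ij}=0$ for every $i\in V^R$, and let $A=(a_{ij})_{i,j\in V}$ be obtained from $A^R$ by removing the last $r$ rows and columns. Let $G^R$ be the graph on $V^R$ with an edge $ij$ whenever $a_{ij}\neq 0$, and let $G$ be the graph on $V$ defined in the same way from $A$. Let $\mathcal M$ be the set of perfect matchings of $G$. A \emph{spanning forest} of $G^R$ is a set $F$ of oriented edges of $G^R$ that contains no cycle and in which each vertex of $V$ has exactly one outgoing edge and the vertices of $R$ have none; equivalently, each connected component is a tree containing exactly one vertex of $R$ (the root), with its edges oriented towards the root. It is \emph{compatible} with $M_0\in\mathcal M$ if, forgetting orientations, it consists of the $n/2$ edges of $M_0$ and of $n/2$ edges not in $M_0$. The \emph{trimming algorithm} applied to such an $F$ sets $F_1=F$ and, as long as $F_i\ne\emptyset$, does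 the following. Let $\ell$ be the leaf of $F_i$ (vertex with an outgoing edge but no incoming edge in $F_i$) with the largest label. Starting from $\ell$, follow the oriented edges of $F_i$ until the first time, after at least one edge, that one reaches a vertex which is in $R$, or has more than one incoming edge in $F_i$, or is smaller than $\ell$. Let $\lambda_i$ be the path obtained, and let $F_{i+1}=F_i\setminus\lambda_i$ (its edges are removed). The forest $F$ satisfies \emph{Condition (C)} with respect to $M_0$ if each path $\lambda_i$ starts with an edge of $M_0$ and has an even number of edges. Let $\mathcal F(M_0)$ be the set of spanning forests of $G^R$ that are compatible with $M_0$ and satisfy Condition (C). Then $$\det(A)=\sum_{M_0\in\mathcal M}\ \sum_{F\in\mathcal F(M_0)}\ \prod_{e\in F}a_e,$$ where $a_e=a_{ij}$ for the oriented edge $e=(i,j)$. -/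

import Mathlib

namespace HalfTree

/-- The graph of a square matrix: `i` and `j` are adjacent when `i ≠ j` and the coefficient is
nonzero (for a skew-symmetric matrix `a i j ≠ 0` and `a j i ≠ 0` are equivalent). -/
def graphOf {K V : Type*} [Zero K] (a : Matrix V V K) : SimpleGraph V :=
  SimpleGraph.fromRel fun i j => a i j ≠ 0

/-- The matrix `A` obtained from `A^R` by removing the last `r` rows and columns. -/
def principal {K : Type*} {n r : ℕ} (AR : Matrix (Fin (n + r)) (Fin (n + r)) K) :
    Matrix (Fin n) (Fin n) K :=
  AR.submatrix (Fin.castAdd r) (Fin.castAdd r)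

/-- The vertices `0, …, n - 1` of `V^R = Fin (n + r)` form `V`; the last `r` ones form `R`. -/
def IsRoot (n : ℕ) {r : ℕ} (v : Fin (n + r)) : Prop := n ≤ v.val

/-- An oriented edge configuration: `(v, w)` is the edge oriented from `v` to `w`. -/
abbrev Config (n r : ℕ) : Type := Finset (Fin (n + r) × Fin (n + r))

/-- The unoriented edges underlying an oriented edge configuration. -/
def support {n r : ℕ} (F : Config n r) : Set (Sym2 (Fin (n + r))) :=
  {e | ∃ v w, (v, w) ∈ F ∧ e = s(v, w)}

/-- The edges of a subgraph of a graph on `V`, seen as unordered pairs of vertices of `V^R`. -/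
def liftedEdges {n : ℕ} (r : ℕ) {G : SimpleGraph (Fin n)} (M : G.Subgraph) :
    Set (Sym2 (Fin (n + r))) :=
  Sym2.map (Fin.castAdd r) '' M.edgeSet

/-- A spanning forest of `G^R` rooted on `R`: an oriented edge configuration without cycles, in
which each vertex of `V` has exactly one outgoing edge and the vertices of `R` have none.
Equivalently, each connected component is a tree that contains exactly one vertex of `R` and is
oriented towards it. (As outdegrees are at most one, a cycle of unoriented edges, or an edge
taken in both directions, would be an oriented cycle.) -/
structure IsSpanningForest {n r : ℕ} (GR : SimpleGraph (Fin (n + r))) (F : Config n r) :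
    Prop where
  edge : ∀ v w, (v, w) ∈ F → GR.Adj v w
  out : ∀ v, ¬ IsRoot n v → ∃! w, (v, w) ∈ F
  root : ∀ v, IsRoot n v → ∀ w, (v, w) ∉ F
  acyclic : ∀ v, ¬ Relation.TransGen (fun x y => (x, y) ∈ F) v v

/-- A spanning forest is compatible with a perfect matching `M₀` of `G` if it consists of the
edges of `M₀` and of `|V| / 2` edges that are not in `M₀`. -/
def IsCompatible {n r : ℕ} {G : SimpleGraph (Fin n)} (M₀ : G.Subgraph) (F : Config n r) :
    Prop :=
  liftedEdges r M₀ ⊆ support F ∧ (support F \ liftedEdges r M₀).ncard = n / 2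

/-- The leaves of `F` : vertices (incident to an edge of `F`) with an outgoing edge and no
incoming edge. -/
def leaves {n r : ℕ} (F : Config n r) : Set (Fin (n + r)) :=
  {v | (∃ w, (v, w) ∈ F) ∧ ∀ u, (u, v) ∉ F}

/-- A fork is a vertex with more than one incoming edge. -/
def IsFork {n r : ℕ} (F : Config n r) (v : Fin (n + r)) : Prop :=
  ∃ u u', u ≠ u' ∧ (u, v) ∈ F ∧ (u', v) ∈ F

/-- The vertices at which the path started at the leaf `l` stops. -/
def IsStop {n r : ℕ} (F : Config n r) (l v : Fin (n + r)) : Prop :=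
  IsRoot n v ∨ IsFork F v ∨ v < l

/-- The oriented edges between consecutive vertices of a path given by its list of vertices. -/
def pathEdges {n r : ℕ} (p : List (Fin (n + r))) : Config n r :=
  (p.zip p.tail).toFinset

/-- `p` is the list of vertices of the path removed from `F` in one step of the trimming
algorithm: it starts at the leaf of `F` with the largest label and follows the edges of `F` up
to the first later vertex which is a root, a fork of `F`, or smaller than the leaf. -/
def IsTrimmedPath {n r : ℕ} (F : Config n r) (p : List (Fin (n + r))) : Prop :=
  ∃ (l : Fin (n + r)) (q : List (Fin (n + r))) (w : Fin (n + r)),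
    p = l :: (q ++ [w]) ∧
    IsGreatest (leaves F) l ∧
    List.IsChain (fun x y => (x, y) ∈ F) p ∧
    (∀ v ∈ q, ¬ IsStop F l v) ∧
    IsStop F l w

/-- `Trims F ps` : the trimming algorithm with input `F` runs until no edge is left and
`ps` is the list of the paths that it removes, in order. -/
inductive Trims {n r : ℕ} : Config n r → List (List (Fin (n + r))) → Prop
  | done : Trims ∅ []
  | step {F : Config n r} {p : List (Fin (n + r))} {ps : List (List (Fin (n + r)))} :
      IsTrimmedPath F p → Trims (F \ pathEdges p) ps → Trims F (p :: ps)

/-- The path `p` (given by its vertices) starts with an edge that belongs to `E`. -/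
def StartsIn {n r : ℕ} (E : Set (Sym2 (Fin (n + r)))) (p : List (Fin (n + r))) : Prop :=
  ∃ v w q, p = v :: w :: q ∧ s(v, w) ∈ E

/-- Condition (C): each path obtained from the trimming algorithm starts with an edge of `M₀`
and has even length (number of edges). -/
def ConditionC {n r : ℕ} {G : SimpleGraph (Fin n)} (M₀ : G.Subgraph) (F : Config n r) : Prop :=
  ∃ ps, Trims F ps ∧ ∀ p ∈ ps, StartsIn (liftedEdges r M₀) p ∧ Even (p.length - 1)

open scoped Classical in
/-- The set `𝓜` of perfect matchings of `G`. -/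
noncomputable def perfectMatchings {n : ℕ} (G : SimpleGraph (Fin n)) : Finset G.Subgraph :=
  Finset.univ.filter fun M => M.IsPerfectMatching

open scoped Classical in
/-- The set `𝓕(M₀)` of spanning forests of `G^R` compatible with `M₀` and satisfying
Condition (C). -/
noncomputable def goodForests {n r : ℕ} (GR : SimpleGraph (Fin (n + r)))
    {G : SimpleGraph (Fin n)} (M₀ : G.Subgraph) : Finset (Config n r) :=
  Finset.univ.filter fun F => IsSpanningForest GR F ∧ IsCompatible M₀ F ∧ ConditionC M₀ F

end HalfTree

/-!
A spanning forest is encoded by its parent map `f`, and the *subtree minimum* of a vertex is the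
smallest label among the vertex and its descendants. The non-root vertices with subtree minimum
`m` form a path `m, f m, f (f m), …`, the class path of `m`. The proof rests on the fact that these
class paths arise from two different explorations of the forest.

* The trimming algorithm removes them by decreasing `m`: below a threshold `t`, the largest leaf is
  the largest subtree minimum, and the path followed from it stops at a root, at a fork or at a
  smaller label exactly when it leaves its class (`IsTopMin.isStop_iff`, `exists_trims`,
  `Trims.exists_mem`). A perfect matching for which the forest is compatible and satisfies
  Condition (C) amounts to an alternating colouring of the class paths, which exists when all of
  them have even length (`colored_of_matching`, `sum_goodForests`).
* They are also the paths of Wilson's algorithm: the class path of the smallest label leads from it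
  to a root; its vertices then become roots, and one continues with the smallest remaining label.
  Following the paths edge by edge gives a recursion for the sum over the coloured forests
  (`walkSum_eq`).

On the other side, since the rows of the matrix have sum zero, the column of any vertex `v` in the
block of `U` can be replaced by the weights of the edges to the roots, and expanding along the row
of `v` gives the recursion of the directed matrix-tree theorem (`walkDet_eq`). It differs from the
one for the coloured forests only in that it also allows paths of odd length, but these leave a
skew-symmetric block of odd size, whose determinant vanishes as `2` is not a zero divisor. Hence
both sides agree (`forestSum_eq_det`).
-/

namespace HalfTree

open Finset Function

/-! ### Rooted parent maps and the smallest label of a subtree -/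

/-- `y` is `x` or a descendant of `x` for the parent map `f`. -/
def Reaches {X : Type*} (f : X → X) (y x : X) : Prop := ∃ k, f^[k] y = x

/-- `f` is the parent map of a forest whose non-root vertices are those of `U`: the vertices
outside `U` are fixed by convention, and iterating `f` always leads out of `U`. -/
structure IsRooted {X : Type*} (U : Finset X) (f : X → X) : Prop where
  off : ∀ x, x ∉ U → f x = x
  exits : ∀ x, ∃ k, f^[k] x ∉ U

section Reach

variable {X : Type*} {f : X → X} {U : Finset X}

lemma Reaches.refl (f : X → X) (x : X) : Reaches f x x := ⟨0, rfl⟩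

lemma Reaches.trans {x y z : X} (h : Reaches f x y) (h' : Reaches f y z) : Reaches f x z := by
  obtain ⟨j, rfl⟩ := h
  obtain ⟨k, rfl⟩ := h'
  exact ⟨k + j, iterate_add_apply ..⟩

lemma reaches_iterate (f : X → X) (x : X) (k : ℕ) : Reaches f x (f^[k] x) := ⟨k, rfl⟩

lemma reaches_apply (f : X → X) (x : X) : Reaches f x (f x) := ⟨1, rfl⟩

lemma Reaches.step {x y : X} (h : Reaches f x y) : Reaches f x (f y) := h.trans (reaches_apply f y)

lemma Reaches.apply_of_ne {x y : X} (h : Reaches f x y) (hne : x ≠ y) : Reaches f (f x) y := by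
  obtain ⟨_ | k, rfl⟩ := h
  · exact absurd rfl hne
  · exact ⟨k, (iterate_succ_apply f k x).symm⟩

/-- A vertex other than `x` below `x` lies below a child of `x`. -/
lemma Reaches.exists_child {x y : X} (h : Reaches f y x) (hne : y ≠ x) :
    ∃ z, f z = x ∧ Reaches f y z := by
  obtain ⟨_ | k, rfl⟩ := h
  · exact absurd rfl hne
  · exact ⟨f^[k] y, (iterate_succ_apply' f k y).symm, reaches_iterate ..⟩

lemma IsRooted.iterate_off (h : IsRooted U f) {x : X} (hx : x ∉ U) (k : ℕ) : f^[k] x = x :=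
  iterate_fixed (h.off x hx) k

lemma IsRooted.mem_of_reaches (h : IsRooted U f) {x y : X} (hr : Reaches f y x) (hx : x ∈ U) :
    y ∈ U := by
  obtain ⟨k, rfl⟩ := hr
  by_contra hy
  exact hy (h.iterate_off hy k ▸ hx)

lemma IsRooted.mem_of_apply (h : IsRooted U f) {x : X} (hx : f x ∈ U) : x ∈ U :=
  h.mem_of_reaches (reaches_apply f x) hx

/-- A rooted parent map has no cycle. -/
lemma IsRooted.iterate_succ_ne (h : IsRooted U f) {x : X} (hx : x ∈ U) (j : ℕ) :
    f^[j + 1] x ≠ x := by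
  intro hj
  obtain ⟨k, hk⟩ := h.exits x
  -- The iterate of order `(j + 1) * k` is `x` by periodicity, but it comes after the exit of `U`.
  have h1 : f^[(j + 1) * k] x = x := by
    rw [iterate_mul]
    exact iterate_fixed hj k
  have h2 : f^[(j + 1) * k] x = f^[k] x := by
    rw [add_mul, one_mul, iterate_add_apply]
    exact h.iterate_off hk _
  exact hk (by rw [← h2, h1]; exact hx)

lemma IsRooted.apply_ne (h : IsRooted U f) {x : X} (hx : x ∈ U) : f x ≠ x :=
  h.iterate_succ_ne hx 0

lemma IsRooted.apply_apply_ne (h : IsRooted U f) {x : X} (hx : x ∈ U) : f (f x) ≠ x :=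
  h.iterate_succ_ne hx 1

lemma IsRooted.not_reaches_of_apply (h : IsRooted U f) {x : X} (hx : x ∈ U) :
    ¬ Reaches f (f x) x := by
  rintro ⟨k, hk⟩
  exact h.iterate_succ_ne hx k (by rw [iterate_succ_apply, hk])

lemma IsRooted.antisymm (h : IsRooted U f) {x y : X} (hx : x ∈ U) (h1 : Reaches f x y)
    (h2 : Reaches f y x) : x = y := by
  by_contra hne
  exact h.not_reaches_of_apply hx ((h1.apply_of_ne hne).trans h2)

/-- The orbit of a vertex is a path, so any two of its vertices are comparable. -/
lemma Reaches.total {m x y : X} (hx : Reaches f m x) (hy : Reaches f m y) :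
    Reaches f x y ∨ Reaches f y x := by
  obtain ⟨i, rfl⟩ := hx
  obtain ⟨j, rfl⟩ := hy
  rcases le_total i j with hij | hij
  · left
    exact ⟨j - i, by rw [← iterate_add_apply, Nat.sub_add_cancel hij]⟩
  · right
    exact ⟨i - j, by rw [← iterate_add_apply, Nat.sub_add_cancel hij]⟩

/-- A vertex lies below at most one child of a given non-root vertex. -/
lemma IsRooted.child_unique (h : IsRooted U f) {m y z : X} (hz : f z ∈ U) (hyz : f y = f z)
    (h1 : Reaches f m y) (h2 : Reaches f m z) : y = z := by
  by_contra hne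
  have hzU := h.mem_of_apply hz
  have hyU := h.mem_of_apply (hyz ▸ hz : f y ∈ U)
  rcases h1.total h2 with h3 | h3
  · exact h.not_reaches_of_apply hzU (hyz ▸ h3.apply_of_ne hne)
  · exact h.not_reaches_of_apply hyU (hyz ▸ h3.apply_of_ne (Ne.symm hne))

end Reach

section SubtreeMin

variable {X : Type*} [Fintype X] [LinearOrder X] {f : X → X} {U : Finset X}

open scoped Classical in
/-- The smallest label in the subtree formed by `x` and its descendants. -/
noncomputable def subtreeMin (f : X → X) (x : X) : X :=
  (univ.filter fun y => Reaches f y x).min' ⟨x, by simpa using Reaches.refl f x⟩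

lemma subtreeMin_reaches (f : X → X) (x : X) : Reaches f (subtreeMin f x) x := by
  classical
  exact (mem_filter.1 (min'_mem (univ.filter fun y => Reaches f y x)
    ⟨x, by simpa using Reaches.refl f x⟩)).2

lemma subtreeMin_le {x y : X} (h : Reaches f y x) : subtreeMin f x ≤ y := by
  classical
  exact min'_le _ _ (by simpa using h)

lemma subtreeMin_le_self (f : X → X) (x : X) : subtreeMin f x ≤ x :=
  subtreeMin_le (Reaches.refl f x)

lemma subtreeMin_anti {x y : X} (h : Reaches f y x) : subtreeMin f x ≤ subtreeMin f y :=
  subtreeMin_le ((subtreeMin_reaches f y).trans h)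

lemma subtreeMin_idem (f : X → X) (x : X) :
    subtreeMin f (subtreeMin f x) = subtreeMin f x :=
  le_antisymm (subtreeMin_le_self f _) (subtreeMin_anti (subtreeMin_reaches f x))

lemma subtreeMin_between {x y : X} (h : Reaches f (subtreeMin f x) y) (h' : Reaches f y x) :
    subtreeMin f y = subtreeMin f x :=
  le_antisymm (subtreeMin_le h) (subtreeMin_anti h')

lemma IsRooted.subtreeMin_mem (h : IsRooted U f) {x : X} (hx : x ∈ U) : subtreeMin f x ∈ U :=
  h.mem_of_reaches (subtreeMin_reaches f x) hx

/-- A vertex that is not the smallest of its subtree has a child with the same subtree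
minimum. -/
lemma exists_child_subtreeMin_eq {x : X} (hx : subtreeMin f x ≠ x) :
    ∃ z, f z = x ∧ subtreeMin f z = subtreeMin f x := by
  obtain ⟨z, hz, hr⟩ := (subtreeMin_reaches f x).exists_child hx
  exact ⟨z, hz, subtreeMin_between hr (hz ▸ reaches_apply f z)⟩

lemma IsRooted.child_unique_of_subtreeMin (h : IsRooted U f) {y z : X} (hz : f z ∈ U)
    (hyz : f y = f z) (hm : subtreeMin f y = subtreeMin f z) : y = z :=
  h.child_unique hz hyz (subtreeMin_reaches f y) (hm ▸ subtreeMin_reaches f z)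

/-- Subtree minima in a set closed under taking children depend only on the parent map on that
set. -/
lemma subtreeMin_congr {f g : X → X} {W : Set X} (hfg : ∀ x ∈ W, f x = g x)
    (hf : ∀ x, f x ∈ W → x ∈ W) (hg : ∀ x, g x ∈ W → x ∈ W) {x : X} (hx : x ∈ W) :
    subtreeMin f x = subtreeMin g x := by
  have key : ∀ (f g : X → X), (∀ x ∈ W, f x = g x) → (∀ x, f x ∈ W → x ∈ W) →
      ∀ (k : ℕ) (y : X), f^[k] y ∈ W → y ∈ W ∧ g^[k] y = f^[k] y := by
    intro f g hfg hf k
    induction k with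
    | zero => exact fun y hy => ⟨hy, rfl⟩
    | succ k ih =>
      intro y hy
      rw [iterate_succ_apply] at hy ⊢
      obtain ⟨h1, h2⟩ := ih _ hy
      have hyW := hf y h1
      exact ⟨hyW, by rw [iterate_succ_apply, ← hfg y hyW, h2]⟩
  have tr : ∀ (f g : X → X), (∀ x ∈ W, f x = g x) → (∀ x, f x ∈ W → x ∈ W) →
      ∀ y, Reaches f y x → Reaches g y x := by
    rintro f g hfg hf y ⟨k, rfl⟩
    exact ⟨k, (key f g hfg hf k y hx).2⟩
  exact le_antisymm (subtreeMin_le (tr g f (fun x hx => (hfg x hx).symm) hg _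
    (subtreeMin_reaches g x))) (subtreeMin_le (tr f g hfg hf _ (subtreeMin_reaches f x)))

/-! ### Alternating colourings of the classes of equal subtree minimum -/

/-- The vertices of `W` with a given subtree minimum `m` form a path that starts at `m`.
`Colored W f c` says that along each of these paths the colours alternate, the first vertex
being coloured `true` and the last one `false`. -/
def Colored (W : Finset X) (f : X → X) (c : X → Bool) : Prop :=
  ∀ y ∈ W, (subtreeMin f y = y → c y = true) ∧
    (f y ∈ W ∧ subtreeMin f (f y) = subtreeMin f y → c (f y) = !c y) ∧
    (¬ (f y ∈ W ∧ subtreeMin f (f y) = subtreeMin f y) → c y = false)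

lemma Colored.congr {f g : X → X} {c d : X → Bool} {W : Finset X} (h : Colored W f c)
    (hfg : ∀ x ∈ W, f x = g x) (hcd : ∀ x ∈ W, c x = d x)
    (hf : ∀ x, f x ∈ W → x ∈ W) (hg : ∀ x, g x ∈ W → x ∈ W) : Colored W g d := by
  have hm : ∀ x ∈ W, subtreeMin f x = subtreeMin g x := fun x hx =>
    subtreeMin_congr (W := (W : Set X)) hfg hf hg hx
  intro y hy
  obtain ⟨h1, h2, h3⟩ := h y hy
  rw [← hm y hy, ← hfg y hy, ← hcd y hy]
  refine ⟨h1, fun h4 => ?_, fun h4 => h3 fun h5 => h4 ?_⟩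
  · rw [← hcd _ h4.1]
    exact h2 ⟨h4.1, by rw [hm _ h4.1]; exact h4.2⟩
  · exact ⟨h5.1, by rw [← hm _ h5.1]; exact h5.2⟩

lemma Colored.congr_iff {f g : X → X} {c d : X → Bool} {W : Finset X}
    (hfg : ∀ x ∈ W, f x = g x) (hcd : ∀ x ∈ W, c x = d x)
    (hf : ∀ x, f x ∈ W → x ∈ W) (hg : ∀ x, g x ∈ W → x ∈ W) :
    Colored W f c ↔ Colored W g d :=
  ⟨fun h => h.congr hfg hcd hf hg, fun h => h.congr (fun x hx => (hfg x hx).symm)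
    (fun x hx => (hcd x hx).symm) hg hf⟩

/-- A forest with non-root vertices `U` and an alternating colouring of its classes; off `U`
the colour is `false` by convention, so that colourings can be counted. -/
def ColoredForest (U : Finset X) (f : X → X) (c : X → Bool) : Prop :=
  IsRooted U f ∧ (∀ x, x ∉ U → c x = false) ∧ Colored U f c

/-- On the path from `v` to its root the colours alternate, starting with `p` and ending with
`false`, and the root at which the path ends is not in `S`. -/
def ColoredPath (U S : Finset X) (v : X) (p : Bool) (f : X → X) (c : X → Bool) : Prop :=
  c v = p ∧ ∀ y ∈ U, Reaches f v y →
    (f y ∈ U → c (f y) = !c y) ∧ (f y ∉ U → c y = false ∧ f y ∉ S)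

open scoped Classical in
/-- The state of an exploration of a forest which has removed some vertices, among them the
beginning `S` of the path that is being followed and now continues at `v`, and for which the
path from `v` and the classes outside that path have still to be checked. -/
def WalkForest (U S : Finset X) (v : X) (p : Bool) (f : X → X) (c : X → Bool) : Prop :=
  IsRooted U f ∧ (∀ x, x ∉ U → c x = false) ∧ ColoredPath U S v p f c ∧
    Colored (U.filter fun x => ¬ Reaches f v x) f c

/-- The class of the smallest non-root vertex `v` is the path from `v` to its root. -/
lemma coloredForest_iff_walkForest {f : X → X} {c : X → Bool} {v : X} (hv : v ∈ U)
    (hmin : ∀ x ∈ U, v ≤ x) :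
    ColoredForest U f c ↔ WalkForest U ∅ v true f c := by
  classical
  unfold ColoredForest WalkForest
  refine and_congr_right fun hr => and_congr_right fun _ => ?_
  have hmu : ∀ y ∈ U, Reaches f v y → subtreeMin f y = v := fun y hy h =>
    le_antisymm (subtreeMin_le h) (hmin _ (hr.subtreeMin_mem hy))
  have hmu' : ∀ y, ¬ Reaches f v y → subtreeMin f y ≠ v := fun y hy h =>
    hy (h ▸ subtreeMin_reaches f y)
  constructor
  · intro h
    refine ⟨⟨(h v hv).1 (hmu v hv (Reaches.refl f v)), fun y hy hvy => ⟨fun h1 => ?_,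
      fun h1 => ?_⟩⟩, fun y hy => ?_⟩
    · exact (h y hy).2.1 ⟨h1, by rw [hmu y hy hvy, hmu _ h1 hvy.step]⟩
    · exact ⟨(h y hy).2.2 fun h2 => h1 h2.1, by simp⟩
    · rw [mem_filter] at hy
      refine ⟨(h y hy.1).1, fun h2 => (h y hy.1).2.1 ⟨(mem_filter.1 h2.1).1, h2.2⟩,
        fun h2 => (h y hy.1).2.2 fun h3 => h2 ⟨mem_filter.2 ⟨h3.1, fun h4 => ?_⟩, h3.2⟩⟩
      exact hmu' y hy.2 (by rw [← h3.2, hmu _ h3.1 h4])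
  · rintro ⟨⟨h1, h2⟩, h3⟩ y hy
    by_cases hvy : Reaches f v y
    · refine ⟨fun h4 => ?_, fun h4 => (h2 y hy hvy).1 h4.1, fun h4 => ?_⟩
      · rw [← h4, hmu y hy hvy, h1]
      · refine ((h2 y hy hvy).2 fun h5 => h4 ⟨h5, ?_⟩).1
        rw [hmu y hy hvy, hmu _ h5 hvy.step]
    · obtain ⟨h4, h5, h6⟩ := h3 y (mem_filter.2 ⟨hy, hvy⟩)
      refine ⟨h4, fun h7 => h5 ⟨mem_filter.2 ⟨h7.1, fun h8 => ?_⟩, h7.2⟩,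
        fun h7 => h6 fun h8 => h7 ⟨(mem_filter.1 h8.1).1, h8.2⟩⟩
      exact hmu' y hvy (by rw [← h7.2, hmu _ h7.1 h8])

end SubtreeMin

/-! ### Removing the first vertex of the explored path -/

section Remove

variable {X : Type*} [DecidableEq X] {f : X → X} {U : Finset X} {v : X}

lemma IsRooted.remove (h : IsRooted U f) : IsRooted (U.erase v) (update f v v) := by
  refine ⟨fun x hx => ?_, fun x => ?_⟩
  · by_cases hxv : x = v
    · simp [hxv]
    · rw [update_of_ne hxv]
      exact h.off x fun hU => hx (mem_erase.2 ⟨hxv, hU⟩)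
  · obtain ⟨k, hk⟩ := h.exits x
    induction k generalizing x with
    | zero => exact ⟨0, fun h' => hk (mem_of_mem_erase h')⟩
    | succ k ih =>
      by_cases hx : x ∈ U.erase v
      · obtain ⟨j, hj⟩ := ih (f x) hk
        refine ⟨j + 1, ?_⟩
        rwa [iterate_succ_apply, update_of_ne (ne_of_mem_erase hx)]
      · exact ⟨0, hx⟩

/-- If `f` is rooted once `v` is made a root, only the orbit of `v` itself remains to be checked. -/
lemma IsRooted.of_remove (h : IsRooted (U.erase v) (update f v v)) (hvU : v ∈ U)
    (hv : ∃ k, f^[k] v ∉ U) : IsRooted U f := by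
  refine ⟨fun x hx => ?_, fun x => ?_⟩
  · have := h.off x fun hU => hx (mem_of_mem_erase hU)
    rwa [update_of_ne (by rintro rfl; exact hx hvU)] at this
  · obtain ⟨j, hj⟩ := h.exits x
    induction j generalizing x with
    | zero =>
      by_cases hxv : x = v
      · exact hxv ▸ hv
      · exact ⟨0, fun hU => hj (mem_erase.2 ⟨hxv, hU⟩)⟩
    | succ j ih =>
      by_cases hxv : x = v
      · exact hxv ▸ hv
      · rw [iterate_succ_apply, update_of_ne hxv] at hj
        obtain ⟨k, hk⟩ := ih _ hj
        exact ⟨k + 1, hk⟩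

/-- The last non-root vertex of an orbit. -/
lemma IsRooted.exists_last (h : IsRooted U f) {x : X} (hx : x ∈ U) :
    ∃ y ∈ U, Reaches f x y ∧ f y ∉ U := by
  obtain ⟨k, hk⟩ := h.exits x
  induction k generalizing x with
  | zero => exact absurd hx hk
  | succ k ih =>
    by_cases hfx : f x ∈ U
    · obtain ⟨y, hy, hr, hy'⟩ := ih hfx hk
      exact ⟨y, hy, (reaches_apply f x).trans hr, hy'⟩
    · exact ⟨x, hx, Reaches.refl f x, hfx⟩

/-- The orbit of `v` continues from `f v` even when `v` is made a root: it may return to `v`, but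
then only repeats itself. -/
lemma reaches_iff_remove {y : X} (hy : y ≠ v) :
    Reaches f v y ↔ Reaches (update f v v) (f v) y := by
  constructor
  · rintro ⟨j, rfl⟩
    have key : ∀ j, f^[j] v = v ∨ Reaches (update f v v) (f v) (f^[j] v) := by
      intro j
      induction j with
      | zero => exact Or.inl rfl
      | succ j ih =>
        right
        rw [iterate_succ_apply']
        by_cases hj : f^[j] v = v
        · rw [hj]
          exact Reaches.refl _ _
        · simpa only [update_of_ne hj] using (ih.resolve_left hj).step
    exact (key j).resolve_left hy
  · rintro ⟨j, rfl⟩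
    clear hy
    induction j with
    | zero => exact reaches_apply f v
    | succ j ih =>
      rw [iterate_succ_apply']
      by_cases hj : (update f v v)^[j] (f v) = v
      · rw [hj, update_self]
        exact Reaches.refl _ _
      · rw [update_of_ne hj]
        exact ih.step

end Remove

section Walk

variable {X : Type*} [Fintype X] [LinearOrder X] {f : X → X} {c : X → Bool} {U S : Finset X}
  {v : X} {p : Bool}

/-- A step of the exploration to a vertex `f v` that is not a root. -/
lemma walkForest_iff_of_mem (hv : v ∈ U) (hk : f v ∈ U.erase v) :
    WalkForest U S v p f c ↔ c v = p ∧
      WalkForest (U.erase v) (insert v S) (f v) (!p) (update f v v) (update c v false) := by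
  classical
  have hkv : f v ≠ v := ne_of_mem_erase hk
  have hkU : f v ∈ U := mem_of_mem_erase hk
  set f' := update f v v with hf'
  set c' := update c v false with hc'
  have ef : ∀ y, y ≠ v → f' y = f y := fun y hy => update_of_ne hy _ _
  have ec : ∀ y, y ≠ v → c' y = c y := fun y hy => update_of_ne hy _ _
  have hoff : (∀ x, x ∉ U → c x = false) ↔ ∀ x, x ∉ U.erase v → c' x = false := by
    constructor
    · intro h x hx
      by_cases hxv : x = v
      · simp [hc', hxv]
      · rw [ec x hxv]
        exact h x fun hU => hx (mem_erase.2 ⟨hxv, hU⟩)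
    · intro h x hx
      rw [← ec x fun h' => hx (h' ▸ hv)]
      exact h x fun h' => hx (mem_of_mem_erase h')
  have hW : (U.erase v).filter (fun x => ¬ Reaches f' (f v) x) =
      U.filter fun x => ¬ Reaches f v x := by
    ext x
    by_cases hxv : x = v
    · subst hxv
      simp [Reaches.refl]
    · simp [hxv, reaches_iff_remove hxv, hf']
  have hcol (hr : IsRooted U f) : Colored (U.filter fun x => ¬ Reaches f v x) f c ↔
      Colored ((U.erase v).filter fun x => ¬ Reaches f' (f v) x) f' c' := by
    have hne : ∀ x ∈ U.filter (fun x => ¬ Reaches f v x), x ≠ v := by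
      rintro x hx rfl
      exact (mem_filter.1 hx).2 (Reaches.refl f x)
    have hcl : ∀ x, f x ∈ U.filter (fun x => ¬ Reaches f v x) →
        x ∈ U.filter (fun x => ¬ Reaches f v x) := fun x hx =>
      mem_filter.2 ⟨hr.mem_of_apply (mem_filter.1 hx).1, fun h => (mem_filter.1 hx).2 h.step⟩
    rw [hW]
    refine Colored.congr_iff (fun x hx => (ef x (hne x hx)).symm)
      (fun x hx => (ec x (hne x hx)).symm) hcl fun x hx => ?_
    by_cases hxv : x = v
    · rw [hxv, hf', update_self] at hx
      exact absurd rfl (hne v hx)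
    · rw [ef x hxv] at hx
      exact hcl x hx
  constructor
  · rintro ⟨hr, h1, ⟨h2, h3⟩, h4⟩
    refine ⟨h2, hr.remove, hoff.1 h1, ⟨?_, fun y hy hvy => ?_⟩, (hcol hr).1 h4⟩
    · rw [ec _ hkv, (h3 v hv (Reaches.refl f v)).1 hkU, h2]
    · obtain ⟨hyv, hyU⟩ := mem_erase.1 hy
      have hvy' := (reaches_iff_remove hyv).2 hvy
      have hfy : f y ≠ v := by
        intro h
        exact hr.not_reaches_of_apply hyU (h ▸ hvy')
      rw [ef y hyv, ec _ hfy, ec y hyv]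
      refine ⟨fun h => (h3 y hyU hvy').1 (mem_of_mem_erase h), fun h => ?_⟩
      have h5 := (h3 y hyU hvy').2 fun h' => h (mem_erase.2 ⟨hfy, h'⟩)
      exact ⟨h5.1, by simp [hfy, h5.2]⟩
  · rintro ⟨h2, hr', h1, ⟨h3, h4⟩, h5⟩
    -- As `v` has been added to the forbidden end points, the path from `f v` does not return
    -- to `v`, so no cycle is created.
    have hnv : ∀ y ∈ U.erase v, Reaches f v y → f y ≠ v := by
      intro y hy hvy hfy
      have h6 := ((h4 y hy ((reaches_iff_remove (ne_of_mem_erase hy)).1 hvy)).2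
        (by rw [ef y (ne_of_mem_erase hy), hfy]; simp)).2
      rw [ef y (ne_of_mem_erase hy), hfy] at h6
      simp at h6
    have hr : IsRooted U f := by
      refine hr'.of_remove hv ?_
      obtain ⟨y, hy, hvy, hfy⟩ := hr'.exists_last hk
      obtain ⟨hyv, hyU⟩ := mem_erase.1 hy
      obtain ⟨k, hk⟩ := ((reaches_iff_remove hyv).2 hvy).step
      refine ⟨k, ?_⟩
      rw [hk]
      intro h
      refine hfy (mem_erase.2 ⟨?_, ?_⟩)
      · rw [ef y hyv]
        exact hnv y hy ((reaches_iff_remove hyv).2 hvy)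
      · rwa [ef y hyv]
    refine ⟨hr, hoff.2 h1, ⟨h2, fun y hyU hvy => ?_⟩, (hcol hr).2 h5⟩
    by_cases hyv : y = v
    · subst hyv
      refine ⟨fun _ => ?_, fun h => absurd hkU h⟩
      rw [← ec _ hkv, h3, h2]
    · have hy := mem_erase.2 ⟨hyv, hyU⟩
      have hfy := hnv y hy hvy
      have h6 := h4 y hy ((reaches_iff_remove hyv).1 hvy)
      rw [ef y hyv, ec _ hfy, ec y hyv] at h6
      refine ⟨fun h => h6.1 (mem_erase.2 ⟨hfy, h⟩), fun h => ?_⟩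
      have h7 := h6.2 fun h' => h (mem_of_mem_erase h')
      exact ⟨h7.1, fun h' => h7.2 (mem_insert_of_mem h')⟩

/-- A step of the exploration to a root `f v`. -/
lemma walkForest_iff_of_notMem (hv : v ∈ U) (hk : f v ∉ U) :
    WalkForest U S v p f c ↔ c v = p ∧ p = false ∧ f v ∉ S ∧
      ColoredForest (U.erase v) (update f v v) (update c v false) := by
  classical
  set f' := update f v v with hf'
  set c' := update c v false with hc'
  have ef : ∀ y, y ≠ v → f' y = f y := fun y hy => update_of_ne hy _ _
  have ec : ∀ y, y ≠ v → c' y = c y := fun y hy => update_of_ne hy _ _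
  have hoff : (∀ x, x ∉ U → c x = false) ↔ ∀ x, x ∉ U.erase v → c' x = false := by
    constructor
    · intro h x hx
      by_cases hxv : x = v
      · simp [hc', hxv]
      · rw [ec x hxv]
        exact h x fun hU => hx (mem_erase.2 ⟨hxv, hU⟩)
    · intro h x hx
      rw [← ec x fun h' => hx (h' ▸ hv)]
      exact h x fun h' => hx (mem_of_mem_erase h')
  have hreach (hr : IsRooted U f) : ∀ y ∈ U, Reaches f v y → y = v := by
    rintro y hy h
    by_contra hne
    obtain ⟨j, hj⟩ := h.apply_of_ne (Ne.symm hne)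
    rw [hr.iterate_off hk] at hj
    exact hk (hj ▸ hy)
  have hcol (hr : IsRooted U f) : Colored (U.filter fun x => ¬ Reaches f v x) f c ↔
      Colored (U.erase v) f' c' := by
    have hW : U.filter (fun x => ¬ Reaches f v x) = U.erase v := by
      ext x
      rw [mem_filter, mem_erase]
      constructor
      · rintro ⟨h1, h2⟩
        exact ⟨fun h => h2 (h ▸ Reaches.refl f v), h1⟩
      · rintro ⟨h1, h2⟩
        exact ⟨h2, fun h => h1 (hreach hr x h2 h)⟩
    have hcl : ∀ x, f x ∈ U.erase v → x ∈ U.erase v := fun x hx =>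
      mem_erase.2 ⟨fun h => hk (h ▸ mem_of_mem_erase hx), hr.mem_of_apply (mem_of_mem_erase hx)⟩
    rw [hW]
    refine Colored.congr_iff (fun x hx => (ef x (ne_of_mem_erase hx)).symm)
      (fun x hx => (ec x (ne_of_mem_erase hx)).symm) hcl fun x hx => ?_
    by_cases hxv : x = v
    · rw [hxv, hf', update_self] at hx
      exact absurd rfl (ne_of_mem_erase hx)
    · rw [ef x hxv] at hx
      exact hcl x hx
  constructor
  · rintro ⟨hr, h1, ⟨h2, h3⟩, h4⟩
    have h5 := (h3 v hv (Reaches.refl f v)).2 hk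
    exact ⟨h2, h2 ▸ h5.1, h5.2, hr.remove, hoff.1 h1, (hcol hr).1 h4⟩
  · rintro ⟨h2, hp, h3, hr', h1, h4⟩
    have hr : IsRooted U f := hr'.of_remove hv ⟨1, hk⟩
    refine ⟨hr, hoff.2 h1, ⟨h2, fun y hy hvy => ?_⟩, (hcol hr).2 h4⟩
    rw [hreach hr y hy hvy]
    exact ⟨fun h => absurd h hk, fun _ => ⟨h2.trans hp, h3⟩⟩

end Walk

/-! ### The determinantal recursion -/

section Det

variable {X K : Type*} [DecidableEq X] [CommRing K] (a : Matrix X X K)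

/-- The block of `-a` with rows and columns in `U`, completed to a matrix on all indices by the
identity, which leaves its determinant unchanged. -/
def block (U : Finset X) : Matrix X X K :=
  Matrix.of fun i j => if i ∈ U ∧ j ∈ U then -a i j else if i = j then 1 else 0

variable {a} {U : Finset X} {v : X}

lemma block_empty : block a ∅ = 1 := by
  ext i j
  simp [block, Matrix.one_apply]

lemma block_row_of_notMem (hv : v ∉ U) : block a U v = Pi.single v 1 := by
  ext j
  by_cases hj : j = v
  · subst hj
    simp [block, hv]
  · simp [block, hv, hj, Ne.symm hj]

variable [Fintype X]

variable (a) in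
/-- The total weight of the edges from each vertex of `U` to the roots that are not in `S`. -/
def exitCol (U S : Finset X) (i : X) : K :=
  if i ∈ U then ∑ k ∈ univ.filter (fun k => k ∉ U ∧ k ∉ S), a i k else 0

variable (a) in
/-- The determinant of the block of `U` with the column of `v` replaced by the exit weights. -/
def walkDet (U S : Finset X) (v : X) : K :=
  ((block a U).updateCol v (exitCol a U S)).det

variable {S : Finset X}

/-- If a row of a matrix is a standard basis vector, the determinant does not depend on the
other entries of the corresponding column. -/
lemma det_congr_of_row_single {A B : Matrix X X K} (v : X) (hA : A v = Pi.single v 1)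
    (hB : B v = Pi.single v 1) (h : ∀ i, i ≠ v → ∀ j, j ≠ v → A i j = B i j) :
    A.det = B.det := by
  refine Matrix.det_eq_of_forall_row_eq_smul_add_const (fun i => A i v - B i v) v
    (by simp [hA, hB]) fun i j => ?_
  rw [hB]
  by_cases hj : j = v
  · subst hj
    simp
  · by_cases hi : i = v
    · subst hi
      simp [hA, hB]
    · simp [hj, h i hi j hj]

/-- Expansion along the row of `v`, parallel to the choice of the edge that leaves `v`. -/
lemma walkDet_eq (hv : v ∈ U) :
    walkDet a U S v = ∑ k ∈ U.erase v, a v k * walkDet a (U.erase v) (insert v S) k +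
      exitCol a U S v * (block a (U.erase v)).det := by
  set N := (block a U).updateCol v (exitCol a U S) with hN
  have hblock : ∀ i, i ≠ v → ∀ j, j ≠ v → block a U i j = block a (U.erase v) i j := by
    intro i hi j hj
    simp [block, hi, hj]
  have h0 : N.det = ∑ k, N v k * (N.updateRow v (Pi.single k 1)).det := by
    rw [Matrix.det_eq_sum_mul_adjugate_row N v]
    simp only [Matrix.adjugate_apply]
  have hvv : N v v * (N.updateRow v (Pi.single v 1)).det =
      exitCol a U S v * (block a (U.erase v)).det := by
    rw [det_congr_of_row_single (B := block a (U.erase v)) v (by simp)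
      (block_row_of_notMem (by simp))]
    · simp [hN]
    · intro i hi j hj
      simp [hN, hi, hj, Matrix.updateRow_apply, hblock i hi j hj]
  have hk : ∀ k ∈ U.erase v, N v k * (N.updateRow v (Pi.single k 1)).det =
      a v k * walkDet a (U.erase v) (insert v S) k := by
    intro k hk
    obtain ⟨hkv, hkU⟩ := mem_erase.1 hk
    have h1 : N v k = -a v k := by
      simp [hN, hkv, block, hv, hkU]
    -- Exchanging the columns of `v` and `k` turns the row of `v` into a basis vector, and brings
    -- the exit weights into the column of `k`.
    have h2 := Matrix.det_permute' (Equiv.swap v k) (N.updateRow v (Pi.single k 1))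
    rw [Equiv.Perm.sign_swap (Ne.symm hkv)] at h2
    have h3 : ((N.updateRow v (Pi.single k 1)).submatrix id (Equiv.swap v k)).det =
        walkDet a (U.erase v) (insert v S) k := by
      refine det_congr_of_row_single v ?_ ?_ fun i hi j hj => ?_
      · ext j
        simp only [Matrix.submatrix_apply, id, Matrix.updateRow_self, Pi.single_apply]
        congr 1
        rw [Equiv.swap_apply_eq_iff, Equiv.swap_apply_right]
      · ext j
        by_cases hj : j = k
        · subst hj
          simp [exitCol, hkv]
        · rw [Matrix.updateCol_ne hj, block_row_of_notMem (by simp)]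
      · rw [Matrix.submatrix_apply, id, Matrix.updateRow_ne hi]
        by_cases hjk : j = k
        · subst hjk
          rw [Equiv.swap_apply_right, hN, Matrix.updateCol_self, Matrix.updateCol_self]
          simp only [exitCol, mem_erase, ne_eq, hi, not_false_eq_true, true_and]
          refine if_congr Iff.rfl (sum_congr ?_ fun _ _ => rfl) rfl
          ext x
          simp only [mem_filter, mem_univ, true_and, mem_insert]
          by_cases hx : x = v
          · simp [hx, hv]
          · simp [hx]
        · rw [Equiv.swap_apply_of_ne_of_ne hj hjk, hN, Matrix.updateCol_ne hj,
            Matrix.updateCol_ne hjk, hblock i hi j hj]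
    rw [← h3, h2, h1]
    simp
  have hout : ∀ k, k ∉ U → N v k * (N.updateRow v (Pi.single k 1)).det = 0 := by
    intro k hk
    have hkv : k ≠ v := fun h => hk (h ▸ hv)
    simp [hN, hkv, block, hk, Ne.symm hkv]
  rw [walkDet, ← hN, h0, ← sum_subset (subset_univ U) fun k _ hk => hout k hk,
    ← sum_erase_add _ _ hv, hvv, sum_congr rfl hk]

/-- As the rows of `a` have sum zero, adding all columns of the block of `U` to the one of `v`
turns the latter into the exit weights. -/
lemma walkDet_empty (hsum : ∀ i, ∑ j, a i j = 0) (hv : v ∈ U) :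
    walkDet a U ∅ v = (block a U).det := by
  have h := Matrix.det_updateCol_sum (block a U) v fun j => if j ∈ U then 1 else 0
  rw [if_pos hv, one_smul] at h
  rw [walkDet, ← h]
  congr 2
  ext i
  simp only [exitCol, smul_eq_mul, ite_mul, one_mul, zero_mul, sum_ite_mem, univ_inter,
    notMem_empty, not_false_eq_true, and_true]
  split_ifs with hi
  · have h1 : ∀ j ∈ U, block a U i j = -a i j := fun j hj => by simp [block, hi, hj]
    rw [sum_congr rfl h1, sum_neg_distrib, eq_neg_iff_add_eq_zero, add_comm]
    have h2 := sum_filter_add_sum_filter_not univ (fun j => j ∈ U) (a i)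
    rw [hsum i] at h2
    simpa using h2
  · rw [sum_eq_zero]
    intro j hj
    have : i ≠ j := fun h => hi (h ▸ hj)
    simp [block, hi, this]

/-- A skew-symmetric block of odd size has determinant zero. -/
lemma det_block_of_odd (two_regular : ∀ x : K, 2 * x = 0 → x = 0) (hskew : a.transpose = -a)
    (hU : Odd U.card) : (block a U).det = 0 := by
  have h1 : (block a U).transpose =
      Matrix.diagonal (fun i => if i ∈ U then (-1 : K) else 1) * block a U := by
    ext i j
    have hij : a j i = -a i j := by
      rw [← Matrix.neg_apply, ← hskew, Matrix.transpose_apply]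
    rw [Matrix.diagonal_mul, Matrix.transpose_apply]
    by_cases h : i = j
    · subst h
      by_cases hi : i ∈ U <;> simp [block, hi, ← hij]
    · by_cases hi : i ∈ U <;> by_cases hj : j ∈ U <;> simp [block, hi, hj, hij, h, Ne.symm h]
  have h2 := congrArg Matrix.det h1
  rw [Matrix.det_transpose, Matrix.det_mul, Matrix.det_diagonal, prod_ite_mem, univ_inter,
    prod_const, hU.neg_one_pow] at h2
  exact two_regular _ (by linear_combination h2)

end Det

/-! ### Weighted sums over coloured forests -/

section Sums

open scoped Classical

variable {X K : Type*} [Fintype X] [LinearOrder X] [CommRing K] (a : Matrix X X K)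

/-- The sum of the weights of the coloured forests with non-root vertices `U`. -/
noncomputable def forestSum (U : Finset X) : K :=
  ∑ x : (X → X) × (X → Bool) with ColoredForest U x.1 x.2, ∏ u ∈ U, a u (x.1 u)

/-- The sum of the weights of the forests in a given state of the exploration. -/
noncomputable def walkSum (U S : Finset X) (v : X) (p : Bool) : K :=
  ∑ x : (X → X) × (X → Bool) with WalkForest U S v p x.1 x.2, ∏ u ∈ U, a u (x.1 u)

variable {a} {U S : Finset X} {v : X} {p : Bool}

/-- Factoring the weight of the edge from `v` to a given vertex `k` out of a sum over forests. -/
lemma sum_forests_with_edge {P Q : (X → X) → (X → Bool) → Prop} {k : X} (hv : v ∈ U)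
    (hPQ : ∀ f c, f v = k → (P f c ↔ c v = p ∧ Q (update f v v) (update c v false)))
    (hQ : ∀ f c, Q f c → f v = v ∧ c v = false) :
    ∑ x : (X → X) × (X → Bool) with P x.1 x.2 ∧ x.1 v = k, ∏ u ∈ U, a u (x.1 u) =
      a v k * ∑ x : (X → X) × (X → Bool) with Q x.1 x.2, ∏ u ∈ U.erase v, a u (x.1 u) := by
  rw [mul_sum]
  refine sum_bij' (fun x _ => (update x.1 v v, update x.2 v false))
    (fun x _ => (update x.1 v k, update x.2 v p)) ?_ ?_ ?_ ?_ ?_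
  · intro x hx
    simp only [mem_filter, mem_univ, true_and] at hx ⊢
    exact ((hPQ _ _ hx.2).1 hx.1).2
  · intro x hx
    simp only [mem_filter, mem_univ, true_and] at hx ⊢
    obtain ⟨h1, h2⟩ := hQ _ _ hx
    refine ⟨(hPQ _ _ (by simp)).2 ⟨by simp, ?_⟩, by simp⟩
    rw [update_idem, update_idem, ← h2]
    nth_rewrite 2 [← h1]
    rwa [update_eq_self, update_eq_self]
  · intro x hx
    simp only [mem_filter, mem_univ, true_and] at hx
    have h1 := ((hPQ _ _ hx.2).1 hx.1).1
    ext1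
    · simp [← hx.2]
    · simp [← h1]
  · intro x hx
    simp only [mem_filter, mem_univ, true_and] at hx
    obtain ⟨h1, h2⟩ := hQ _ _ hx
    ext1
    · simp only [update_idem]
      nth_rewrite 2 [← h1]
      rw [update_eq_self]
    · simp only [update_idem]
      rw [← h2, update_eq_self]
  · intro x hx
    simp only [mem_filter, mem_univ, true_and] at hx
    rw [← mul_prod_erase _ _ hv, hx.2]
    congr 1
    refine prod_congr rfl fun u hu => ?_
    simp only [update_of_ne (ne_of_mem_erase hu)]

lemma walkSum_eq (hv : v ∈ U) :
    walkSum a U S v p = ∑ k ∈ U.erase v, a v k * walkSum a (U.erase v) (insert v S) k (!p) +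
      if p = false then exitCol a U S v * forestSum a (U.erase v) else 0 := by
  have h0 : walkSum a U S v p = ∑ k, ∑ x : (X → X) × (X → Bool) with
      WalkForest U S v p x.1 x.2 ∧ x.1 v = k, ∏ u ∈ U, a u (x.1 u) := by
    rw [walkSum, ← sum_fiberwise _ fun x => x.1 v]
    simp only [filter_filter]
  have h1 : ∀ k ∈ U.erase v, ∑ x : (X → X) × (X → Bool) with
      WalkForest U S v p x.1 x.2 ∧ x.1 v = k, ∏ u ∈ U, a u (x.1 u) =
        a v k * walkSum a (U.erase v) (insert v S) k (!p) := by
    intro k hk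
    refine sum_forests_with_edge hv
      (P := WalkForest U S v p) (Q := WalkForest (U.erase v) (insert v S) k (!p))
      (p := p) ?_ ?_
    · rintro f c rfl
      exact walkForest_iff_of_mem hv hk
    · exact fun f c h => ⟨h.1.off v (by simp), h.2.1 v (by simp)⟩
  have h2 : ∀ k ∉ U, ∑ x : (X → X) × (X → Bool) with
      WalkForest U S v p x.1 x.2 ∧ x.1 v = k, ∏ u ∈ U, a u (x.1 u) =
        if p = false ∧ k ∉ S then a v k * forestSum a (U.erase v) else 0 := by
    intro k hk
    split_ifs with hp
    · refine sum_forests_with_edge hv (P := WalkForest U S v p) (Q := ColoredForest (U.erase v))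
        (p := p) ?_ ?_
      · rintro f c rfl
        rw [walkForest_iff_of_notMem hv hk]
        simp [hp]
      · exact fun f c h => ⟨h.1.off v (by simp), h.2.1 v (by simp)⟩
    · refine sum_eq_zero fun x hx => absurd ?_ hp
      simp only [mem_filter, mem_univ, true_and] at hx
      obtain ⟨hw, rfl⟩ := hx
      have := (walkForest_iff_of_notMem hv hk).1 hw
      exact ⟨this.2.1, this.2.2.1⟩
  have h3 : ∑ x : (X → X) × (X → Bool) with
      WalkForest U S v p x.1 x.2 ∧ x.1 v = v, ∏ u ∈ U, a u (x.1 u) = 0 := by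
    refine sum_eq_zero fun x hx => ?_
    simp only [mem_filter, mem_univ, true_and] at hx
    exact absurd hx.2 (hx.1.1.apply_ne hv)
  rw [h0, ← sum_filter_add_sum_filter_not univ (fun k => k ∈ U), filter_mem_eq_inter, univ_inter,
    ← sum_erase_add _ _ hv, h3, add_zero, sum_congr rfl h1,
    sum_congr rfl fun k hk => h2 k (mem_filter.1 hk).2]
  congr 1
  split_ifs with hp
  · simp only [hp, true_and, exitCol, hv, if_true]
    rw [← sum_filter, filter_filter, sum_mul]
  · simp [hp]

lemma coloredForest_empty_iff {f : X → X} {c : X → Bool} :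
    ColoredForest ∅ f c ↔ f = id ∧ c = fun _ => false := by
  constructor
  · rintro ⟨h1, h2, -⟩
    exact ⟨funext fun x => h1.off x (by simp), funext fun x => h2 x (by simp)⟩
  · rintro ⟨rfl, rfl⟩
    exact ⟨⟨fun _ _ => rfl, fun x => ⟨0, by simp⟩⟩, fun _ _ => rfl, fun y hy => by simp at hy⟩

lemma forestSum_empty : forestSum a ∅ = 1 := by
  have : (univ.filter fun x : (X → X) × (X → Bool) => ColoredForest ∅ x.1 x.2) =
      {(id, fun _ => false)} := by
    ext x
    simp [coloredForest_empty_iff, Prod.ext_iff]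
  rw [forestSum, this]
  simp

lemma forestSum_eq_walkSum (hv : v ∈ U) (hmin : ∀ x ∈ U, v ≤ x) :
    forestSum a U = walkSum a U ∅ v true := by
  simp only [forestSum, walkSum, coloredForest_iff_walkForest hv hmin]

/-- Forest sums and determinants satisfy the same recursion: an exploration step to a root
requires the colour `false`, hence leaves a block of even size, while the blocks of odd size
contribute nothing to the determinant. -/
lemma forestSum_and_walkSum (two_regular : ∀ x : K, 2 * x = 0 → x = 0)
    (hskew : a.transpose = -a) (hsum : ∀ i, ∑ j, a i j = 0) (N : ℕ) :
    ∀ U : Finset X, U.card = N → (Even N → forestSum a U = (block a U).det) ∧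
      ∀ S v p, v ∈ U → (p = true ↔ Even N) → walkSum a U S v p = walkDet a U S v := by
  induction N with
  | zero =>
    intro U hU
    rw [card_eq_zero] at hU
    subst hU
    exact ⟨fun _ => by simp [forestSum_empty, block_empty], fun S v p hv => by simp at hv⟩
  | succ N ih =>
    intro U hU
    have hw : ∀ S v p, v ∈ U → (p = true ↔ Even (N + 1)) →
        walkSum a U S v p = walkDet a U S v := by
      intro S v p hv hp
      have hcard : (U.erase v).card = N := by rw [card_erase_of_mem hv, hU, Nat.add_sub_cancel]
      obtain ⟨ih1, ih2⟩ := ih _ hcard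
      have hp' : (!p) = true ↔ Even N := by
        rw [Nat.even_add_one] at hp
        cases p <;> simp_all
      rw [walkSum_eq hv, walkDet_eq hv]
      congr 1
      · exact sum_congr rfl fun k hk => by rw [ih2 _ k _ hk hp']
      · split_ifs with h
        · rw [ih1 (hp'.1 (by simp [h]))]
        · have : Odd (U.erase v).card := by
            rw [hcard, ← Nat.not_even_iff_odd, ← hp']
            simpa using h
          rw [det_block_of_odd two_regular hskew this, mul_zero]
    refine ⟨fun hN => ?_, hw⟩
    have hne : U.Nonempty := card_pos.1 (by omega)
    have hv := min'_mem U hne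
    rw [forestSum_eq_walkSum hv fun x hx => min'_le U x hx, hw ∅ _ _ hv (by simp [hN]),
      walkDet_empty hsum hv]

theorem forestSum_eq_det (two_regular : ∀ x : K, 2 * x = 0 → x = 0)
    (hskew : a.transpose = -a) (hsum : ∀ i, ∑ j, a i j = 0) (hU : Even U.card) :
    forestSum a U = (block a U).det :=
  (forestSum_and_walkSum two_regular hskew hsum _ U rfl).1 hU

end Sums

/-! ### Class paths -/

section ClassPath

variable {X : Type*} [Fintype X] [LinearOrder X] {U : Finset X} {f : X → X}

/-- The vertices of `U` whose subtree minimum is `m` are `m, f m, …, f^[k - 1] m`: the orbit of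
`m` stays among them for `k` steps and then leaves them. -/
def IsClassPath (U : Finset X) (f : X → X) (m : X) (k : ℕ) : Prop :=
  (∀ j < k, f^[j] m ∈ U ∧ subtreeMin f (f^[j] m) = m) ∧
    ¬ (f^[k] m ∈ U ∧ subtreeMin f (f^[k] m) = m)

lemma IsRooted.exists_classPath (h : IsRooted U f) (m : X) : ∃ k, IsClassPath U f m k := by
  classical
  have hex : ∃ k, ¬ (f^[k] m ∈ U ∧ subtreeMin f (f^[k] m) = m) := by
    obtain ⟨k, hk⟩ := h.exits m
    exact ⟨k, fun h' => hk h'.1⟩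
  exact ⟨Nat.find hex, fun j hj => not_not.1 (Nat.find_min hex hj), Nat.find_spec hex⟩

lemma IsClassPath.pos {m : X} {k : ℕ} (h : IsClassPath U f m k) (hm : m ∈ U)
    (hm' : subtreeMin f m = m) : 0 < k := by
  rcases Nat.eq_zero_or_pos k with rfl | hk
  · exact absurd ⟨hm, hm'⟩ h.2
  · exact hk

lemma IsClassPath.lt_of_mem (hr : IsRooted U f) {m : X} {k j : ℕ} (h : IsClassPath U f m k)
    (hj : f^[j] m ∈ U) (hj' : subtreeMin f (f^[j] m) = m) : j < k := by
  by_contra hlt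
  have h1 : Reaches f (f^[k] m) (f^[j] m) :=
    ⟨j - k, by rw [← iterate_add_apply, Nat.sub_add_cancel (not_lt.1 hlt)]⟩
  refine h.2 ⟨hr.mem_of_reaches h1 hj, le_antisymm (subtreeMin_le (reaches_iterate ..)) ?_⟩
  exact hj'.symm.le.trans (subtreeMin_anti h1)

lemma IsClassPath.exists_index (hr : IsRooted U f) {m x : X} {k : ℕ} (h : IsClassPath U f m k)
    (hx : x ∈ U) (hm : subtreeMin f x = m) : ∃ j < k, f^[j] m = x := by
  obtain ⟨j, hj⟩ := subtreeMin_reaches f x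
  rw [hm] at hj
  exact ⟨j, h.lt_of_mem hr (hj ▸ hx) (hj ▸ hm), hj⟩

end ClassPath

/-! ### The trimming algorithm removes the class paths by decreasing minimum -/

section Trim

variable {n r : ℕ}

/-- The vertices of `V` among those of `V^R`. -/
def nonRoots (n r : ℕ) : Finset (Fin (n + r)) := univ.filter fun v => v.val < n

lemma mem_nonRoots {v : Fin (n + r)} : v ∈ nonRoots n r ↔ ¬ IsRoot n v := by
  simp [nonRoots, IsRoot]

/-- The edges of the forest with parent map `f` that start in a class of minimum below `t`. -/
noncomputable def edgesBelow (f : Fin (n + r) → Fin (n + r)) (t : ℕ) : Config n r :=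
  univ.filter fun e => e.1 ∈ nonRoots n r ∧ (subtreeMin f e.1).val < t ∧ f e.1 = e.2

/-- The list of the first vertices of the orbit of `l`, up to the `k`-th iterate. -/
def orbitList {X : Type*} (f : X → X) (l : X) (k : ℕ) : List X :=
  (List.range (k + 1)).map fun j => f^[j] l

/-- `l` is the largest subtree minimum below `t`. -/
def IsTopMin (f : Fin (n + r) → Fin (n + r)) (t : ℕ) (l : Fin (n + r)) : Prop :=
  IsGreatest {m | m ∈ nonRoots n r ∧ subtreeMin f m = m ∧ m.val < t} l

variable {f : Fin (n + r) → Fin (n + r)} {t : ℕ} {l : Fin (n + r)}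

lemma mem_edgesBelow {x y : Fin (n + r)} :
    (x, y) ∈ edgesBelow f t ↔ x ∈ nonRoots n r ∧ (subtreeMin f x).val < t ∧ f x = y := by
  simp [edgesBelow]

lemma IsTopMin.subtreeMin_le (hl : IsTopMin f t l) (hr : IsRooted (nonRoots n r) f)
    {x : Fin (n + r)} (hx : x ∈ nonRoots n r) (hxt : (subtreeMin f x).val < t) :
    subtreeMin f x ≤ l :=
  hl.2 ⟨hr.subtreeMin_mem hx, subtreeMin_idem f x, hxt⟩

lemma exists_isTopMin (h : ∃ m ∈ nonRoots n r, subtreeMin f m = m ∧ m.val < t) :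
    ∃ l, IsTopMin f t l := by
  classical
  obtain ⟨m, hm⟩ := h
  have hne : ((nonRoots n r).filter fun m => subtreeMin f m = m ∧ m.val < t).Nonempty :=
    ⟨m, by simpa using hm⟩
  refine ⟨_, by simpa using max'_mem _ hne, fun x hx => ?_⟩
  exact le_max' _ _ (by simpa using hx)

lemma leaf_isMin (hr : IsRooted (nonRoots n r) f) (h : l ∈ leaves (edgesBelow f t)) :
    l ∈ nonRoots n r ∧ subtreeMin f l = l ∧ l.val < t := by
  obtain ⟨⟨w, hw⟩, hno⟩ := h
  obtain ⟨h1, h2, -⟩ := mem_edgesBelow.1 hw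
  have h3 : subtreeMin f l = l := by
    by_contra hne
    obtain ⟨z, hz, hm⟩ := exists_child_subtreeMin_eq hne
    exact hno z (mem_edgesBelow.2 ⟨hr.mem_of_apply (hz ▸ h1), hm ▸ h2, hz⟩)
  exact ⟨h1, h3, h3 ▸ h2⟩

lemma IsTopMin.isGreatest_leaves (hr : IsRooted (nonRoots n r) f) (hl : IsTopMin f t l) :
    IsGreatest (leaves (edgesBelow f t)) l := by
  obtain ⟨h1, h2, h3⟩ := hl.1
  refine ⟨⟨⟨f l, mem_edgesBelow.2 ⟨h1, by rwa [h2], rfl⟩⟩, fun u hu => ?_⟩,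
    fun x hx => hl.2 (leaf_isMin hr hx)⟩
  obtain ⟨hu1, hu2, hu3⟩ := mem_edgesBelow.1 hu
  have hul : Reaches f u l := hu3 ▸ reaches_apply f u
  have h4 : subtreeMin f u = l :=
    le_antisymm (hl.subtreeMin_le hr hu1 hu2) (h2 ▸ subtreeMin_anti hul)
  have h5 := hr.antisymm hu1 hul (h4 ▸ subtreeMin_reaches f u)
  exact hr.apply_ne hu1 (hu3.trans h5.symm)

lemma isTopMin_of_isGreatest_leaves (hr : IsRooted (nonRoots n r) f)
    (h : IsGreatest (leaves (edgesBelow f t)) l) : IsTopMin f t l := by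
  obtain ⟨l', hl'⟩ := exists_isTopMin ⟨l, leaf_isMin hr h.1⟩
  exact h.unique (hl'.isGreatest_leaves hr) ▸ hl'

/-- The trimmed path stops exactly when it leaves the class of its first vertex: at a fork, the
other incoming edge comes from a class of smaller minimum. -/
lemma IsTopMin.isStop_iff (hr : IsRooted (nonRoots n r) f) (hl : IsTopMin f t l)
    {z : Fin (n + r)} (hz : z ∈ nonRoots n r) (hzl : subtreeMin f z = l) :
    IsStop (edgesBelow f t) l (f z) ↔ ¬ (f z ∈ nonRoots n r ∧ subtreeMin f (f z) = l) := by
  have hlt := hl.1.2.2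
  constructor
  · rintro (h | h | h) ⟨h1, h2⟩
    · exact mem_nonRoots.1 h1 h
    · obtain ⟨u, u', hne, hu, hu'⟩ := h
      have key : ∀ u, (u, f z) ∈ edgesBelow f t → subtreeMin f u = l ∧ f u = f z := by
        intro u hu
        obtain ⟨hu1, hu2, hu3⟩ := mem_edgesBelow.1 hu
        refine ⟨le_antisymm (hl.subtreeMin_le hr hu1 hu2) ?_, hu3⟩
        exact h2 ▸ subtreeMin_anti (hu3 ▸ reaches_apply f u)
      obtain ⟨h3, h4⟩ := key u hu
      obtain ⟨h5, h6⟩ := key u' hu'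
      exact hne (hr.child_unique_of_subtreeMin (h6 ▸ h1) (h4.trans h6.symm) (h3.trans h5.symm))
    · exact absurd (h2 ▸ subtreeMin_le_self f (f z)) (not_le.2 h)
  · intro h
    by_cases hU : f z ∈ nonRoots n r
    · have hne : subtreeMin f (f z) ≠ l := fun h' => h ⟨hU, h'⟩
      have hlt' : subtreeMin f (f z) < l :=
        lt_of_le_of_ne (hzl ▸ subtreeMin_anti (reaches_apply f z)) hne
      by_cases hself : subtreeMin f (f z) = f z
      · exact Or.inr (Or.inr (hself ▸ hlt'))
      · obtain ⟨y, hy, hym⟩ := exists_child_subtreeMin_eq hself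
        refine Or.inr (Or.inl ⟨z, y, ?_, mem_edgesBelow.2 ⟨hz, hzl ▸ hlt, rfl⟩,
          mem_edgesBelow.2 ⟨hr.mem_of_apply (hy ▸ hU), ?_, hy⟩⟩)
        · rintro rfl
          exact hne (hym ▸ hzl)
        · rw [hym]
          exact lt_trans hlt' hlt
    · exact Or.inl (not_not.1 fun h' => hU (mem_nonRoots.2 h'))

lemma length_orbitList (k : ℕ) : (orbitList f l k).length = k + 1 := by simp [orbitList]

lemma orbitList_succ (k : ℕ) : orbitList f l (k + 1) =
    l :: ((List.range k).map (fun j => f^[j + 1] l) ++ [f^[k + 1] l]) := by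
  rw [orbitList, List.range_succ_eq_map, List.map_cons, List.range_succ, List.map_append,
    List.map_append, List.map_map]
  rfl

lemma mem_pathEdges_orbitList {k : ℕ} {e : Fin (n + r) × Fin (n + r)} :
    e ∈ pathEdges (orbitList f l k) ↔ ∃ j < k, e = (f^[j] l, f^[j + 1] l) := by
  simp only [pathEdges, List.mem_toFinset, List.mem_iff_getElem, List.getElem_zip,
    List.length_zip, List.length_tail, List.getElem_tail, orbitList, List.getElem_map,
    List.getElem_range]
  constructor
  · rintro ⟨j, hj, rfl⟩
    exact ⟨j, by simpa using hj, rfl⟩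
  · rintro ⟨j, hj, rfl⟩
    exact ⟨j, by simpa using hj, rfl⟩

/-- A list that follows the edges of a parent map is an initial piece of an orbit. -/
lemma eq_orbitList_of_isChain {q : List (Fin (n + r))}
    (h : List.IsChain (fun x y => f x = y) (l :: q)) : l :: q = orbitList f l q.length := by
  refine List.ext_getElem (by simp [orbitList]) fun i h1 h2 => ?_
  rw [List.isChain_iff_getElem] at h
  simp only [orbitList, List.getElem_map, List.getElem_range]
  clear h2
  induction i with
  | zero => rfl
  | succ i ih => rw [← h i h1, ih (by omega), ← iterate_succ_apply' f i l]

lemma IsTopMin.isTrimmedPath_iff (hr : IsRooted (nonRoots n r) f) (hl : IsTopMin f t l)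
    {p : List (Fin (n + r))} :
    IsTrimmedPath (edgesBelow f t) p ↔
      ∃ k, IsClassPath (nonRoots n r) f l k ∧ p = orbitList f l k := by
  have hlU := hl.1.1
  have hlm := hl.1.2.1
  constructor
  · rintro ⟨l', q, w, rfl, hl', hchain, hq, hw⟩
    obtain rfl : l' = l := hl'.unique (hl.isGreatest_leaves hr)
    have hp := eq_orbitList_of_isChain
      (hchain.imp fun x y h => (mem_edgesBelow.1 h).2.2)
    rw [List.length_append, List.length_singleton] at hp
    refine ⟨q.length + 1, ?_, hp⟩
    rw [orbitList_succ, List.cons.injEq] at hp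
    obtain ⟨hq', hw'⟩ := List.append_inj' hp.2 rfl
    rw [List.cons.injEq] at hw'
    obtain ⟨rfl, -⟩ := hw'
    have hcl : ∀ j < q.length + 1,
        f^[j] l' ∈ nonRoots n r ∧ subtreeMin f (f^[j] l') = l' := by
      intro j
      induction j with
      | zero => exact fun _ => ⟨hlU, hlm⟩
      | succ j ih =>
        intro hj
        obtain ⟨h1, h2⟩ := ih (by omega)
        have h3 := hq (f^[j + 1] l') (by
          rw [hq']
          exact List.mem_map.2 ⟨j, List.mem_range.2 (by omega), rfl⟩)
        rw [iterate_succ_apply', hl.isStop_iff hr h1 h2, not_not] at h3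
        rwa [iterate_succ_apply']
    refine ⟨hcl, ?_⟩
    obtain ⟨h1, h2⟩ := hcl q.length (by omega)
    rw [iterate_succ_apply'] at hw ⊢
    exact (hl.isStop_iff hr h1 h2).1 hw
  · rintro ⟨k, hk, rfl⟩
    obtain ⟨k, rfl⟩ := Nat.exists_eq_succ_of_ne_zero (hk.pos hlU hlm).ne'
    refine ⟨l, _, _, orbitList_succ k, hl.isGreatest_leaves hr, ?_, ?_, ?_⟩
    · rw [List.isChain_iff_getElem]
      intro j hj
      rw [length_orbitList] at hj
      simp only [orbitList, List.getElem_map, List.getElem_range]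
      obtain ⟨h1, h2⟩ := hk.1 j (by omega)
      exact mem_edgesBelow.2 ⟨h1, by rw [h2]; exact hl.1.2.2, (iterate_succ_apply' f j l).symm⟩
    · intro v hv
      obtain ⟨j, hj, rfl⟩ := List.mem_map.1 hv
      rw [List.mem_range] at hj
      obtain ⟨h1, h2⟩ := hk.1 j (by omega)
      have h3 := hk.1 (j + 1) (by omega)
      rw [iterate_succ_apply'] at h3 ⊢
      rwa [hl.isStop_iff hr h1 h2, not_not]
    · obtain ⟨h1, h2⟩ := hk.1 k (by omega)
      have h3 := hk.2
      rw [iterate_succ_apply'] at h3 ⊢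
      rwa [hl.isStop_iff hr h1 h2]

/-- Trimming the class path of the largest minimum below `t` lowers the threshold to that
minimum. -/
lemma IsTopMin.edgesBelow_sdiff (hr : IsRooted (nonRoots n r) f) (hl : IsTopMin f t l) {k : ℕ}
    (hk : IsClassPath (nonRoots n r) f l k) :
    edgesBelow f t \ pathEdges (orbitList f l k) = edgesBelow f l.val := by
  ext ⟨x, y⟩
  rw [mem_sdiff, mem_pathEdges_orbitList, mem_edgesBelow, mem_edgesBelow]
  constructor
  · rintro ⟨⟨h1, h2, h3⟩, h4⟩
    refine ⟨h1, lt_of_le_of_ne (hl.subtreeMin_le hr h1 h2) fun h5 => h4 ?_, h3⟩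
    obtain ⟨j, hj, rfl⟩ := hk.exists_index hr h1 (Fin.ext h5)
    exact ⟨j, hj, by rw [iterate_succ_apply', h3]⟩
  · rintro ⟨h1, h2, h3⟩
    refine ⟨⟨h1, h2.trans hl.1.2.2, h3⟩, ?_⟩
    rintro ⟨j, hj, he⟩
    rw [show x = f^[j] l from (Prod.ext_iff.1 he).1, (hk.1 j hj).2] at h2
    exact lt_irrefl _ h2

lemma edgesBelow_eq_empty (hr : IsRooted (nonRoots n r) f) :
    edgesBelow f t = ∅ ↔ ¬ ∃ m ∈ nonRoots n r, subtreeMin f m = m ∧ m.val < t := by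
  constructor
  · rintro h ⟨m, h1, h2, h3⟩
    have : (m, f m) ∈ edgesBelow f t := mem_edgesBelow.2 ⟨h1, h2.symm ▸ h3, rfl⟩
    simp [h] at this
  · intro h
    refine eq_empty_of_forall_notMem ?_
    rintro ⟨x, y⟩ hx
    obtain ⟨h1, h2, -⟩ := mem_edgesBelow.1 hx
    exact h ⟨_, hr.subtreeMin_mem h1, subtreeMin_idem f x, h2⟩

/-- Every class path occurs among the paths removed by the trimming algorithm. -/
lemma Trims.exists_mem (hr : IsRooted (nonRoots n r) f) {F : Config n r}
    {ps : List (List (Fin (n + r)))} (h : Trims F ps) :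
    ∀ t, F = edgesBelow f t → ∀ m ∈ nonRoots n r, subtreeMin f m = m → m.val < t →
      ∃ k, IsClassPath (nonRoots n r) f m k ∧ orbitList f m k ∈ ps := by
  induction h with
  | done =>
    intro t ht m h1 h2 h3
    exact absurd ⟨m, h1, h2, h3⟩ ((edgesBelow_eq_empty hr).1 ht.symm)
  | @step F p ps hp _ ih =>
    rintro t rfl m h1 h2 h3
    obtain ⟨l, q, w, -, hl, -⟩ := id hp
    have hl := isTopMin_of_isGreatest_leaves hr hl
    obtain ⟨k, hk, rfl⟩ := (hl.isTrimmedPath_iff hr).1 hp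
    by_cases hml : m = l
    · subst hml
      exact ⟨k, hk, List.mem_cons_self⟩
    · obtain ⟨j, hj, hmem⟩ := ih _ (hl.edgesBelow_sdiff hr hk) m h1 h2
        (lt_of_le_of_ne (hl.2 ⟨h1, h2, h3⟩) (Fin.val_ne_of_ne hml))
      exact ⟨j, hj, List.mem_cons_of_mem _ hmem⟩

/-- The trimming algorithm terminates, and it removes only class paths. -/
lemma exists_trims (hr : IsRooted (nonRoots n r) f) (t : ℕ) :
    ∃ ps, Trims (edgesBelow f t) ps ∧ ∀ p ∈ ps, ∃ m ∈ nonRoots n r, subtreeMin f m = m ∧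
      ∃ k, IsClassPath (nonRoots n r) f m k ∧ p = orbitList f m k := by
  induction t using Nat.strong_induction_on with
  | _ t ih =>
    by_cases hex : ∃ m ∈ nonRoots n r, subtreeMin f m = m ∧ m.val < t
    · obtain ⟨l, hl⟩ := exists_isTopMin hex
      obtain ⟨k, hk⟩ := hr.exists_classPath l
      obtain ⟨ps, h1, h2⟩ := ih l.val hl.1.2.2
      refine ⟨orbitList f l k :: ps, ?_, ?_⟩
      · refine Trims.step ((hl.isTrimmedPath_iff hr).2 ⟨k, hk, rfl⟩) ?_
        rwa [hl.edgesBelow_sdiff hr hk]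
      · intro p hp
        rcases List.mem_cons.1 hp with rfl | hp
        · exact ⟨l, hl.1.1, hl.1.2.1, k, hk, rfl⟩
        · exact h2 p hp
    · refine ⟨[], ?_, by simp⟩
      rw [(edgesBelow_eq_empty hr).2 hex]
      exact Trims.done

end Trim

/-! ### Alternating colourings and matchings -/

section Alternating

variable {X : Type*} [Fintype X] [LinearOrder X] {U : Finset X} {f : X → X} {c : X → Bool}

/-- Suppose that every vertex of `U` is incident to an edge `(x, f x)` with `c x = true`, that no
two such edges are consecutive, and that each class path starts with such an edge and has even
length. Then the colours alternate along the class paths: an edge of colour `true` that enters a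
class path from outside would be the last edge of a class path of larger minimum, whose colour is
`false` by induction as that path has even length. -/
lemma colored_of_matching (hr : IsRooted U f) (hnext : ∀ x ∈ U, c x = true → c (f x) = false)
    (hcover : ∀ x ∈ U, c x = false → ∃ y ∈ U, f y = x ∧ c y = true)
    (hpath : ∀ m ∈ U, subtreeMin f m = m → c m = true ∧ ∃ k, IsClassPath U f m k ∧ Even k) :
    Colored U f c := by
  have key : ∀ m, m ∈ U → subtreeMin f m = m → ∀ k, IsClassPath U f m k → ∀ j < k,
      (c (f^[j] m) = true ↔ Even j) := by
    intro m
    induction m using WellFoundedGT.induction with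
    | _ m ih =>
      intro hm hmm k hk j
      induction j with
      | zero => simpa using fun _ => (hpath m hm hmm).1
      | succ j ihj =>
        intro hj
        have ihj := ihj (by omega)
        obtain ⟨h1, h2⟩ := hk.1 j (by omega)
        obtain ⟨h3, h4⟩ := hk.1 (j + 1) hj
        rw [Nat.even_add_one, ← ihj]
        rw [iterate_succ_apply'] at h3 h4 ⊢
        constructor
        · intro h5 h6
          rw [hnext _ h1 h6] at h5
          exact absurd h5 (by simp)
        · intro h5
          by_contra h6
          obtain ⟨y, hy, hyx, hcy⟩ := hcover _ h3 (by simpa using h6)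
          have hne : subtreeMin f y ≠ m := by
            intro h7
            exact h5 (hr.child_unique_of_subtreeMin h3 hyx (h7.trans h2.symm) ▸ hcy)
          have hlt : m < subtreeMin f y :=
            lt_of_le_of_ne (h4 ▸ subtreeMin_anti (hyx ▸ reaches_apply f y)) (Ne.symm hne)
          have hmy := hr.subtreeMin_mem hy
          obtain ⟨-, k', hk', hek'⟩ := hpath _ hmy (subtreeMin_idem f y)
          obtain ⟨i, hi, hiy⟩ := hk'.exists_index hr hy rfl
          have hlast : i + 1 = k' := by
            by_contra h8
            have h9 := hk'.1 (i + 1) (by omega)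
            rw [iterate_succ_apply', hiy, hyx, h4] at h9
            exact hne h9.2.symm
          have hei := (ih _ hlt hmy (subtreeMin_idem f y) k' hk' i hi).1 (by rw [hiy, hcy])
          rw [← hlast, Nat.even_add_one] at hek'
          exact hek' hei
  intro y hy
  have hmy := hr.subtreeMin_mem hy
  obtain ⟨-, k, hk, hek⟩ := hpath _ hmy (subtreeMin_idem f y)
  obtain ⟨j, hj, hjy⟩ := hk.exists_index hr hy rfl
  have hcj := key _ hmy (subtreeMin_idem f y) k hk j hj
  rw [hjy] at hcj
  refine ⟨fun h => (hpath y hy h).1, fun h => ?_, fun h => ?_⟩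
  · have hj1 : j + 1 < k := by
      refine hk.lt_of_mem hr ?_ ?_
      · rw [iterate_succ_apply', hjy]
        exact h.1
      · rw [iterate_succ_apply', hjy]
        exact h.2
    have h1 := key _ hmy (subtreeMin_idem f y) k hk (j + 1) hj1
    rw [iterate_succ_apply', hjy, Nat.even_add_one, ← hcj] at h1
    cases h2 : c y <;> simp_all
  · have hlast : j + 1 = k := by
      by_contra h1
      have h2 := hk.1 (j + 1) (by omega)
      rw [iterate_succ_apply', hjy] at h2
      exact h h2
    rw [← hlast, Nat.even_add_one, ← hcj] at hek
    simpa using hek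

lemma Colored.class_next (h : Colored U f c) {x : X} (hx : x ∈ U) (hc : c x = true) :
    f x ∈ U ∧ subtreeMin f (f x) = subtreeMin f x := by
  by_contra h'
  have := (h x hx).2.2 h'
  simp [hc] at this

lemma Colored.next (h : Colored U f c) {x : X} (hx : x ∈ U) (hc : c x = true) :
    c (f x) = false := by
  rw [(h x hx).2.1 (h.class_next hx hc), hc]
  rfl

lemma Colored.prev (hr : IsRooted U f) (h : Colored U f c) {x : X} (hx : x ∈ U)
    (hc : c x = false) : ∃ y ∈ U, f y = x ∧ c y = true := by
  have hne : subtreeMin f x ≠ x := by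
    intro h'
    simp [(h x hx).1 h'] at hc
  obtain ⟨y, rfl, hm⟩ := exists_child_subtreeMin_eq hne
  have hy := hr.mem_of_apply hx
  refine ⟨y, hy, rfl, ?_⟩
  rw [(h y hy).2.1 ⟨hx, hm.symm⟩] at hc
  simpa using hc

lemma Colored.prev_unique (hr : IsRooted U f) (h : Colored U f c) {x y : X} (hx : x ∈ U)
    (hy : y ∈ U) (hcx : c x = true) (hcy : c y = true) (hxy : f x = f y) : x = y :=
  hr.child_unique_of_subtreeMin (h.class_next hy hcy).1 hxy
    (by rw [← (h.class_next hx hcx).2, ← (h.class_next hy hcy).2, hxy])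

lemma Colored.even_length (h : Colored U f c) {m : X} {k : ℕ} (hm : m ∈ U)
    (hmm : subtreeMin f m = m) (hk : IsClassPath U f m k) : Even k := by
  have key : ∀ j < k, (c (f^[j] m) = true ↔ Even j) := by
    intro j
    induction j with
    | zero => simpa using fun _ => (h m hm).1 hmm
    | succ j ih =>
      intro hj
      obtain ⟨h1, h2⟩ := hk.1 j (by omega)
      obtain ⟨h3, h4⟩ := hk.1 (j + 1) hj
      rw [iterate_succ_apply'] at h3 h4 ⊢
      rw [Nat.even_add_one, ← ih (by omega), (h _ h1).2.1 ⟨h3, h4.trans h2.symm⟩]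
      simp
  obtain ⟨k, rfl⟩ := Nat.exists_eq_succ_of_ne_zero (hk.pos hm hmm).ne'
  obtain ⟨h1, h2⟩ := hk.1 k (by omega)
  have h3 := hk.2
  rw [iterate_succ_apply'] at h3
  have h4 := (h _ h1).2.2 (by rwa [h2])
  rw [Nat.succ_eq_add_one, Nat.even_add_one, ← key k (by omega), h4]
  simp

/-- The edges of colour `true` join the vertices of `U` in pairs. -/
lemma Colored.card_true_eq_card_false (hr : IsRooted U f) (h : Colored U f c) :
    (U.filter fun x => c x = true).card = (U.filter fun x => c x = false).card := by
  refine card_bij (fun x _ => f x) ?_ ?_ ?_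
  · intro x hx
    obtain ⟨h1, h2⟩ := mem_filter.1 hx
    exact mem_filter.2 ⟨(h.class_next h1 h2).1, h.next h1 h2⟩
  · intro x hx y hy hxy
    obtain ⟨h1, h2⟩ := mem_filter.1 hx
    obtain ⟨h3, h4⟩ := mem_filter.1 hy
    exact h.prev_unique hr h1 h3 h2 h4 hxy
  · intro x hx
    obtain ⟨h1, h2⟩ := mem_filter.1 hx
    obtain ⟨y, hy, hyx, hc⟩ := h.prev hr h1 h2
    exact ⟨y, mem_filter.2 ⟨hy, hc⟩, hyx⟩

end Alternating

/-! ### Spanning forests and parent maps -/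

section Forest

variable {n r : ℕ} {f : Fin (n + r) → Fin (n + r)}

lemma castAdd_mem_nonRoots (i : Fin n) : Fin.castAdd r i ∈ nonRoots n r := by
  simp [nonRoots]

lemma exists_castAdd {x : Fin (n + r)} (hx : x ∈ nonRoots n r) : ∃ i, Fin.castAdd r i = x :=
  ⟨⟨x.val, by simpa [nonRoots] using hx⟩, rfl⟩

lemma card_nonRoots (n r : ℕ) : (nonRoots n r).card = n := by
  have : nonRoots n r = univ.image (Fin.castAdd r) := by
    ext x
    simp only [mem_image, mem_univ, true_and]
    exact ⟨exists_castAdd, fun ⟨i, hi⟩ => hi ▸ castAdd_mem_nonRoots i⟩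
  rw [this, card_image_of_injective _ (Fin.castAdd_injective n r), card_fin]

lemma IsRooted.mem_edgesBelow (hr : IsRooted (nonRoots n r) f) {x y : Fin (n + r)} :
    (x, y) ∈ edgesBelow f n ↔ x ∈ nonRoots n r ∧ f x = y := by
  rw [HalfTree.mem_edgesBelow]
  constructor
  · exact fun h => ⟨h.1, h.2.2⟩
  · refine fun h => ⟨h.1, ?_, h.2⟩
    simpa [nonRoots] using hr.subtreeMin_mem h.1

lemma IsRooted.prod_edgesBelow {K : Type*} [CommRing K] (hr : IsRooted (nonRoots n r) f)
    (a : Matrix (Fin (n + r)) (Fin (n + r)) K) :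
    ∏ e ∈ edgesBelow f n, a e.1 e.2 = ∏ u ∈ nonRoots n r, a u (f u) := by
  symm
  refine prod_bij (fun u _ => (u, f u)) (fun u hu => hr.mem_edgesBelow.2 ⟨hu, rfl⟩)
    (fun u _ u' _ h => (Prod.ext_iff.1 h).1) ?_ fun _ _ => rfl
  rintro ⟨x, y⟩ h
  obtain ⟨h1, h2⟩ := hr.mem_edgesBelow.1 h
  exact ⟨x, h1, by rw [h2]⟩

lemma IsRooted.isSpanningForest (hr : IsRooted (nonRoots n r) f)
    {GR : SimpleGraph (Fin (n + r))} (hadj : ∀ x ∈ nonRoots n r, GR.Adj x (f x)) :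
    IsSpanningForest GR (edgesBelow f n) := by
  refine ⟨fun v w h => ?_, fun v hv => ?_, fun v hv w h => ?_, fun v h => ?_⟩
  · obtain ⟨h1, rfl⟩ := hr.mem_edgesBelow.1 h
    exact hadj v h1
  · exact ⟨f v, hr.mem_edgesBelow.2 ⟨mem_nonRoots.2 hv, rfl⟩,
      fun w hw => (hr.mem_edgesBelow.1 hw).2.symm⟩
  · exact mem_nonRoots.1 (hr.mem_edgesBelow.1 h).1 hv
  · have key : ∀ {x y}, Relation.TransGen (fun x y => (x, y) ∈ edgesBelow f n) x y →
        x ∈ nonRoots n r ∧ Reaches f (f x) y := by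
      intro x y h
      induction h with
      | single h =>
        obtain ⟨h1, h2⟩ := hr.mem_edgesBelow.1 h
        exact ⟨h1, h2 ▸ Reaches.refl f _⟩
      | tail _ h ih =>
        obtain ⟨-, h2⟩ := hr.mem_edgesBelow.1 h
        exact ⟨ih.1, h2 ▸ ih.2.step⟩
    obtain ⟨h1, h2⟩ := key h
    exact hr.not_reaches_of_apply h1 h2

/-- A spanning forest is described by its parent map. -/
lemma IsSpanningForest.exists_parent {GR : SimpleGraph (Fin (n + r))} {F : Config n r}
    (hF : IsSpanningForest GR F) :
    ∃ f, IsRooted (nonRoots n r) f ∧ F = edgesBelow f n ∧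
      ∀ x ∈ nonRoots n r, GR.Adj x (f x) := by
  classical
  have hout : ∀ x, ∃ y, (x ∈ nonRoots n r → (x, y) ∈ F) ∧ (x ∉ nonRoots n r → y = x) := by
    intro x
    by_cases hx : x ∈ nonRoots n r
    · obtain ⟨w, hw, -⟩ := hF.out x (mem_nonRoots.1 hx)
      exact ⟨w, fun _ => hw, fun h => absurd hx h⟩
    · exact ⟨x, fun h => absurd h hx, fun _ => rfl⟩
  choose f hf hf' using hout
  have hr : IsRooted (nonRoots n r) f := by
    refine ⟨hf', fun x => ?_⟩
    by_contra! hall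
    have hgen : ∀ i j, i < j →
        Relation.TransGen (fun x y => (x, y) ∈ F) (f^[i] x) (f^[j] x) := by
      intro i j hij
      induction j, hij using Nat.le_induction with
      | base =>
        rw [iterate_succ_apply']
        exact Relation.TransGen.single (hf _ (hall i))
      | succ j _ ih =>
        rw [iterate_succ_apply']
        exact ih.tail (hf _ (hall j))
    obtain ⟨i, j, hij, he⟩ := Finite.exists_ne_map_eq_of_infinite fun k => f^[k] x
    rcases lt_or_gt_of_ne hij with h | h
    · exact hF.acyclic _ (he ▸ hgen i j h : Relation.TransGen _ (f^[i] x) (f^[i] x))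
    · exact hF.acyclic _ (he ▸ hgen j i h : Relation.TransGen _ (f^[j] x) (f^[j] x))
  refine ⟨f, hr, ?_, fun x hx => hF.edge _ _ (hf x hx)⟩
  ext ⟨x, y⟩
  rw [hr.mem_edgesBelow]
  constructor
  · intro h
    have hx : x ∈ nonRoots n r := mem_nonRoots.2 fun hx => hF.root x hx y h
    exact ⟨hx, (hF.out x (mem_nonRoots.1 hx)).unique (hf x hx) h⟩
  · rintro ⟨hx, rfl⟩
    exact hf x hx

end Forest

/-! ### Coloured forests and pairs of a matching and a compatible forest -/

section Matching

variable {n r : ℕ} {f : Fin (n + r) → Fin (n + r)} {c : Fin (n + r) → Bool}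
  {G : SimpleGraph (Fin n)}

lemma mk_mem_liftedEdges {M : G.Subgraph} {x y : Fin (n + r)} :
    s(x, y) ∈ liftedEdges r M ↔
      ∃ i j, M.Adj i j ∧ Fin.castAdd r i = x ∧ Fin.castAdd r j = y := by
  constructor
  · rintro ⟨e, he, hexy⟩
    induction e using Sym2.ind with
    | _ i j =>
      rw [SimpleGraph.Subgraph.mem_edgeSet] at he
      rw [Sym2.map_mk, Sym2.eq_iff] at hexy
      rcases hexy with ⟨h1, h2⟩ | ⟨h1, h2⟩
      · exact ⟨i, j, he, h1, h2⟩
      · exact ⟨j, i, he.symm, h2, h1⟩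
  · rintro ⟨i, j, h, rfl, rfl⟩
    exact ⟨s(i, j), SimpleGraph.Subgraph.mem_edgeSet.2 h, by simp⟩

lemma castAdd_mem_liftedEdges {M : G.Subgraph} {i j : Fin n} :
    s(Fin.castAdd r i, Fin.castAdd r j) ∈ liftedEdges r M ↔ M.Adj i j := by
  rw [mk_mem_liftedEdges]
  constructor
  · rintro ⟨i', j', h, h1, h2⟩
    rwa [← Fin.castAdd_injective n r h1, ← Fin.castAdd_injective n r h2]
  · exact fun h => ⟨i, j, h, rfl, rfl⟩

/-- The edges of `G` of the form `(x, f x)` with `c x = true`, as a spanning subgraph. -/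
def matchingOf (G : SimpleGraph (Fin n)) (f : Fin (n + r) → Fin (n + r))
    (c : Fin (n + r) → Bool) : G.Subgraph where
  verts := Set.univ
  Adj i j := G.Adj i j ∧
    ((c (Fin.castAdd r i) = true ∧ f (Fin.castAdd r i) = Fin.castAdd r j) ∨
      (c (Fin.castAdd r j) = true ∧ f (Fin.castAdd r j) = Fin.castAdd r i))
  adj_sub h := h.1
  edge_vert _ := Set.mem_univ _
  symm := ⟨fun _ _ h => ⟨h.1.symm, h.2.symm⟩⟩

variable {GR : SimpleGraph (Fin (n + r))}

lemma mem_lifted_matchingOf_iff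
    (hG : ∀ i j, GR.Adj (Fin.castAdd r i) (Fin.castAdd r j) → G.Adj i j)
    (hc : ColoredForest (nonRoots n r) f c)
    (hadj : ∀ x ∈ nonRoots n r, GR.Adj x (f x)) {x : Fin (n + r)} (hx : x ∈ nonRoots n r) :
    s(x, f x) ∈ liftedEdges r (matchingOf G f c) ↔ c x = true := by
  obtain ⟨hr, -, hcol⟩ := hc
  rw [mk_mem_liftedEdges]
  constructor
  · rintro ⟨i, j, ⟨-, h | h⟩, rfl, hj⟩
    · exact h.1
    · rw [hj] at h
      exact absurd h.2 (hr.apply_apply_ne hx)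
  · intro h
    obtain ⟨i, rfl⟩ := exists_castAdd hx
    obtain ⟨j, hj⟩ := exists_castAdd (hcol.class_next hx h).1
    exact ⟨i, j, ⟨hG i j (hj ▸ hadj _ hx), Or.inl ⟨h, hj.symm⟩⟩, rfl, hj⟩

lemma matchingOf_isPerfectMatching
    (hG : ∀ i j, GR.Adj (Fin.castAdd r i) (Fin.castAdd r j) → G.Adj i j)
    (hc : ColoredForest (nonRoots n r) f c)
    (hadj : ∀ x ∈ nonRoots n r, GR.Adj x (f x)) : (matchingOf G f c).IsPerfectMatching := by
  obtain ⟨hr, -, hcol⟩ := hc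
  refine ⟨fun v _ => ?_, fun v => Set.mem_univ v⟩
  have hv := castAdd_mem_nonRoots (r := r) v
  by_cases h : c (Fin.castAdd r v) = true
  · obtain ⟨w, hw⟩ := exists_castAdd (hcol.class_next hv h).1
    refine ⟨w, ⟨hG v w (hw ▸ hadj _ hv), Or.inl ⟨h, hw.symm⟩⟩, ?_⟩
    rintro w' ⟨-, h' | h'⟩
    · exact Fin.castAdd_injective n r (h'.2.symm.trans hw.symm)
    · have h1 := hcol.next (castAdd_mem_nonRoots w') h'.1
      rw [h'.2, h] at h1
      simp at h1
  · rw [Bool.not_eq_true] at h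
    obtain ⟨y, hy, hyv, hcy⟩ := hcol.prev hr hv h
    obtain ⟨w, rfl⟩ := exists_castAdd hy
    refine ⟨w, ⟨(hG w v (hyv ▸ hadj _ hy)).symm, Or.inr ⟨hcy, hyv⟩⟩, ?_⟩
    rintro w' ⟨-, h' | h'⟩
    · simp [h] at h'
    · exact Fin.castAdd_injective n r (hcol.prev_unique hr (castAdd_mem_nonRoots w') hy h'.1 hcy
        (h'.2.trans hyv.symm))

lemma matchingOf_isCompatible
    (hG : ∀ i j, GR.Adj (Fin.castAdd r i) (Fin.castAdd r j) → G.Adj i j)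
    (hc : ColoredForest (nonRoots n r) f c)
    (hadj : ∀ x ∈ nonRoots n r, GR.Adj x (f x)) :
    IsCompatible (matchingOf G f c) (edgesBelow f n) := by
  classical
  have hlift := fun x hx => mem_lifted_matchingOf_iff hG hc hadj (x := x) hx
  obtain ⟨hr, -, hcol⟩ := hc
  constructor
  · rintro ⟨x, y⟩ he
    obtain ⟨i, j, ⟨-, h | h⟩, rfl, rfl⟩ := mk_mem_liftedEdges.1 he
    · exact ⟨_, _, hr.mem_edgesBelow.2 ⟨castAdd_mem_nonRoots i, h.2⟩, rfl⟩
    · exact ⟨_, _, hr.mem_edgesBelow.2 ⟨castAdd_mem_nonRoots j, h.2⟩, Sym2.eq_swap⟩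
  · have h1 : support (edgesBelow f n) \ liftedEdges r (matchingOf G f c) =
        (fun x => s(x, f x)) '' ((nonRoots n r).filter fun x => c x = false : Finset _) := by
      ext e
      constructor
      · rintro ⟨⟨v, w, hvw, rfl⟩, h2⟩
        obtain ⟨hv, rfl⟩ := hr.mem_edgesBelow.1 hvw
        rw [hlift v hv, Bool.not_eq_true] at h2
        exact ⟨v, by simpa using ⟨hv, h2⟩, rfl⟩
      · rintro ⟨x, hx, rfl⟩
        obtain ⟨h2, h3⟩ := mem_filter.1 (mem_coe.1 hx)
        refine ⟨⟨x, f x, hr.mem_edgesBelow.2 ⟨h2, rfl⟩, rfl⟩, fun h4 => ?_⟩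
        rw [hlift x h2, h3] at h4
        simp at h4
    rw [h1, Set.InjOn.ncard_image, Set.ncard_coe_finset]
    · have h2 := card_filter_add_card_filter_not (s := nonRoots n r) fun x => c x = true
      simp only [Bool.not_eq_true] at h2
      rw [hcol.card_true_eq_card_false hr, card_nonRoots] at h2
      omega
    · intro x hx y _ hxy
      have hx := (mem_filter.1 (mem_coe.1 hx)).1
      rcases Sym2.eq_iff.1 hxy with h | ⟨h2, h3⟩
      · exact h.1
      · exact absurd (h3.symm ▸ h2.symm : f (f x) = x) (hr.apply_apply_ne hx)

lemma matchingOf_conditionC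
    (hG : ∀ i j, GR.Adj (Fin.castAdd r i) (Fin.castAdd r j) → G.Adj i j)
    (hc : ColoredForest (nonRoots n r) f c)
    (hadj : ∀ x ∈ nonRoots n r, GR.Adj x (f x)) :
    ConditionC (matchingOf G f c) (edgesBelow f n) := by
  obtain ⟨ps, hps, hall⟩ := exists_trims hc.1 n
  refine ⟨ps, hps, fun p hp => ?_⟩
  obtain ⟨m, hm, hmm, k, hk, rfl⟩ := hall p hp
  have hek := hc.2.2.even_length hm hmm hk
  have hpos := hk.pos hm hmm
  obtain ⟨k, rfl⟩ := Nat.exists_eq_succ_of_ne_zero hpos.ne'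
  refine ⟨?_, by simpa [length_orbitList] using hek⟩
  have hq : ∃ q, orbitList f m (k + 1) = m :: f m :: q := by
    rw [orbitList, List.range_succ_eq_map, List.range_succ_eq_map]
    exact ⟨_, rfl⟩
  obtain ⟨q, hq⟩ := hq
  exact ⟨m, f m, q, hq, (mem_lifted_matchingOf_iff hG hc hadj hm).2 ((hc.2.2 m hm).1 hmm)⟩

/-- The colouring that marks the edges of a matching turns a compatible forest which satisfies
Condition (C) into a coloured forest. -/
lemma exists_coloring {M : G.Subgraph} (hM : M.IsPerfectMatching)
    (hr : IsRooted (nonRoots n r) f) (hsub : liftedEdges r M ⊆ support (edgesBelow f n))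
    (hC : ConditionC M (edgesBelow f n)) :
    ∃ c, ColoredForest (nonRoots n r) f c ∧ matchingOf G f c = M := by
  classical
  have hc : ∃ c : Fin (n + r) → Bool, ∀ x,
      c x = true ↔ x ∈ nonRoots n r ∧ s(x, f x) ∈ liftedEdges r M :=
    ⟨fun x => decide (x ∈ nonRoots n r ∧ s(x, f x) ∈ liftedEdges r M), by simp⟩
  obtain ⟨c, hc⟩ := hc
  have hedge : ∀ i j, M.Adj i j →
      (c (Fin.castAdd r i) = true ∧ f (Fin.castAdd r i) = Fin.castAdd r j) ∨
        (c (Fin.castAdd r j) = true ∧ f (Fin.castAdd r j) = Fin.castAdd r i) := by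
    intro i j hij
    have h1 : s(Fin.castAdd r i, Fin.castAdd r j) ∈ liftedEdges r M :=
      castAdd_mem_liftedEdges.2 hij
    obtain ⟨v, w, hvw, he⟩ := hsub h1
    obtain ⟨hv, rfl⟩ := hr.mem_edgesBelow.1 hvw
    have h2 := (hc v).2 ⟨hv, he ▸ h1⟩
    rcases Sym2.eq_iff.1 he with ⟨rfl, h3⟩ | ⟨h3, rfl⟩
    · exact Or.inl ⟨h2, h3.symm⟩
    · exact Or.inr ⟨h2, h3.symm⟩
  refine ⟨c, ⟨hr, fun x hx => ?_, colored_of_matching hr ?_ ?_ ?_⟩, ?_⟩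
  · rw [← Bool.not_eq_true, hc]
    exact fun h => hx h.1
  · intro x hx hcx
    rw [← Bool.not_eq_true]
    intro hcf
    obtain ⟨i, j, hij, rfl, hj⟩ := mk_mem_liftedEdges.1 ((hc x).1 hcx).2
    obtain ⟨j', k, hjk, hj', hk⟩ := mk_mem_liftedEdges.1 ((hc _).1 hcf).2
    obtain rfl : j' = j := Fin.castAdd_injective n r (hj'.trans hj.symm)
    obtain rfl : k = i := (hM.1 (hM.2 j')).unique hjk hij.symm
    exact hr.apply_apply_ne hx hk.symm
  · intro x hx hcx
    obtain ⟨i, rfl⟩ := exists_castAdd hx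
    obtain ⟨j, hij, -⟩ := hM.1 (hM.2 i)
    rcases hedge i j hij with h | h
    · simp [hcx] at h
    · exact ⟨_, castAdd_mem_nonRoots j, h.2, h.1⟩
  · intro m hm hmm
    obtain ⟨ps, hps, hall⟩ := hC
    have hmn : m.val < n := by simpa [nonRoots] using hm
    obtain ⟨k, hk, hkps⟩ := hps.exists_mem hr n rfl m hm hmm hmn
    obtain ⟨⟨v, w, q, hq, hvw⟩, heven⟩ := hall _ hkps
    rw [length_orbitList, Nat.add_sub_cancel] at heven
    refine ⟨?_, k, hk, heven⟩
    obtain ⟨k, rfl⟩ := Nat.exists_eq_succ_of_ne_zero (hk.pos hm hmm).ne'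
    rw [orbitList, List.range_succ_eq_map, List.range_succ_eq_map] at hq
    simp only [List.map_cons, List.cons.injEq] at hq
    obtain ⟨rfl, rfl, -⟩ := hq
    exact (hc _).2 ⟨hm, hvw⟩
  · refine SimpleGraph.Subgraph.ext (SimpleGraph.Subgraph.IsSpanning.verts_eq_univ hM.2).symm ?_
    ext i j
    constructor
    · rintro ⟨-, ⟨h1, h2⟩ | ⟨h1, h2⟩⟩
      · exact castAdd_mem_liftedEdges.1 (h2 ▸ ((hc _).1 h1).2)
      · exact (castAdd_mem_liftedEdges.1 (h2 ▸ ((hc _).1 h1).2)).symm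
    · exact fun h => ⟨M.adj_sub h, hedge i j h⟩

open scoped Classical in
/-- The pairs of a perfect matching and a compatible forest satisfying Condition (C) correspond
to the coloured forests all of whose edges are in the graph. -/
lemma sum_goodForests {K : Type*} [CommRing K] (a : Matrix (Fin (n + r)) (Fin (n + r)) K)
    (hG : ∀ i j, GR.Adj (Fin.castAdd r i) (Fin.castAdd r j) → G.Adj i j) :
    ∑ M₀ ∈ perfectMatchings G, ∑ F ∈ goodForests GR M₀, ∏ e ∈ F, a e.1 e.2 =
      ∑ x : (Fin (n + r) → Fin (n + r)) × (Fin (n + r) → Bool) with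
        ColoredForest (nonRoots n r) x.1 x.2 ∧ ∀ u ∈ nonRoots n r, GR.Adj u (x.1 u),
          ∏ u ∈ nonRoots n r, a u (x.1 u) := by
  rw [sum_sigma']
  symm
  refine sum_bij (fun x _ => ⟨matchingOf G x.1 x.2, edgesBelow x.1 n⟩) ?_ ?_ ?_ ?_
  · rintro ⟨f, c⟩ hx
    obtain ⟨-, hc, hadj⟩ := mem_filter.1 hx
    simp only [perfectMatchings, goodForests, mem_sigma, mem_filter, mem_univ, true_and]
    exact ⟨matchingOf_isPerfectMatching hG hc hadj, hc.1.isSpanningForest hadj,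
      matchingOf_isCompatible hG hc hadj, matchingOf_conditionC hG hc hadj⟩
  · rintro ⟨f, c⟩ hx ⟨g, d⟩ hy hxy
    obtain ⟨-, hc, hadj⟩ := mem_filter.1 hx
    obtain ⟨-, hd, hadj'⟩ := mem_filter.1 hy
    rw [Sigma.mk.injEq] at hxy
    obtain ⟨hM, hF⟩ := hxy
    have hF := eq_of_heq hF
    obtain rfl : f = g := by
      funext u
      by_cases hu : u ∈ nonRoots n r
      · have h1 : (u, f u) ∈ edgesBelow f n := hc.1.mem_edgesBelow.2 ⟨hu, rfl⟩
        rw [hF] at h1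
        exact (hd.1.mem_edgesBelow.1 h1).2.symm
      · exact (hc.1.off u hu).trans (hd.1.off u hu).symm
    obtain rfl : c = d := by
      funext u
      by_cases hu : u ∈ nonRoots n r
      · have h1 := mem_lifted_matchingOf_iff hG hc hadj hu
        have h2 := mem_lifted_matchingOf_iff hG hd hadj' hu
        rw [hM] at h1
        exact Bool.eq_iff_iff.2 (h1.symm.trans h2)
      · exact (hc.2.1 u hu).trans (hd.2.1 u hu).symm
    rfl
  · rintro ⟨M, F⟩ hMF
    simp only [perfectMatchings, goodForests, mem_sigma, mem_filter, mem_univ, true_and] at hMF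
    obtain ⟨hM, hF, hcomp, hC⟩ := hMF
    obtain ⟨f, hr, rfl, hadj⟩ := hF.exists_parent
    obtain ⟨c, hc, rfl⟩ := exists_coloring hM hr hcomp.1 hC
    exact ⟨(f, c), mem_filter.2 ⟨mem_univ _, hc, hadj⟩, rfl⟩
  · rintro ⟨f, c⟩ hx
    obtain ⟨-, hc, -⟩ := mem_filter.1 hx
    exact (hc.1.prod_edgesBelow a).symm

end Matching

lemma det_block_nonRoots {K : Type*} [CommRing K] {n r : ℕ} (hn : Even n)
    (a : Matrix (Fin (n + r)) (Fin (n + r)) K) :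
    (block a (nonRoots n r)).det = (principal a).det := by
  have h1 : (block a (nonRoots n r)).submatrix finSumFinEquiv finSumFinEquiv =
      Matrix.fromBlocks (-principal a) 0 0 1 := by
    ext i j
    rcases i with i | i <;> rcases j with j | j <;>
      simp [block, nonRoots, principal, Matrix.one_apply, Fin.ext_iff]
    all_goals omega
  rw [← Matrix.det_submatrix_equiv_self finSumFinEquiv, h1, Matrix.det_fromBlocks_zero₂₁,
    Matrix.det_one, mul_one, Matrix.det_neg, Fintype.card_fin, hn.neg_one_pow, one_mul]

end HalfTree

theorem mainTheorem2 {K : Type*} [CommRing K] (two_regular : ∀ x : K, 2 * x = 0 → x = 0)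
    (n r : ℕ) (hn : Even n)
    (AR : Matrix (Fin (n + r)) (Fin (n + r)) K)
    (skew : AR.transpose = -AR)
    (column_sum : ∀ i, ∑ j, AR i j = 0) :
    (HalfTree.principal AR).det =
      ∑ M₀ ∈ HalfTree.perfectMatchings (HalfTree.graphOf (HalfTree.principal AR)),
        ∑ F ∈ HalfTree.goodForests (HalfTree.graphOf AR) M₀,
          ∏ e ∈ F, AR e.1 e.2 := by
  classical
  rw [HalfTree.sum_goodForests AR, ← HalfTree.det_block_nonRoots hn,
    ← HalfTree.forestSum_eq_det two_regular skew column_sum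
      (by rwa [HalfTree.card_nonRoots]), HalfTree.forestSum, ← Finset.filter_filter]
  · symm
    -- A forest with an edge outside `G^R` has weight zero.
    refine Finset.sum_filter_of_ne fun x hx hne u hu => ?_
    have hx := (Finset.mem_filter.1 hx).2
    have hu' := hx.1.apply_ne hu
    have h1 : AR u (x.1 u) ≠ 0 := fun h => hne (Finset.prod_eq_zero hu h)
    exact (SimpleGraph.fromRel_adj _ _ _).2 ⟨hu'.symm, Or.inl h1⟩
  · intro i j h
    obtain ⟨h1, h2⟩ := (SimpleGraph.fromRel_adj _ _ _).1 h
    exact (SimpleGraph.fromRel_adj _ _ _).2 ⟨fun h3 => h1 (h3 ▸ rfl), h2⟩
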